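/- **Rectilinear Steiner arborescence (RSA).** An input is a sequence $Q=(p_1,\dots,p_N)$, $p_i=(x_i,y_i)$, of points of the closed positive quadrant with $y_1\le\dots\le y_N$. A feasible solution is a finite set of horizontal and vertical segments such that every $p_i$ is reached from the origin by a rectilinear path inside the union of the segments that is both $x$-monotone and $y$-monotone. The cost of a solution is the sum of the lengths of its segments; $\mathrm{OPT}(Q)$ is the least cost of a feasible solution, and $x_{\max}(Q)=\max_i x_i$. Online, the points arrive one by one; segments are never deleted, and the segments added for $p_i$ lie in the region $y\ge y_{i-1}$ (where $y_0=0$). **The grid-rounding algorithm with parameter $n$.** Let $\delta=\lceil \log n/\log\log n\rceil$. The point $p_i$ is rounded to the replica $r_i=(v_i,t_i)=(\lfloor x_i\rfloor,\lceil y_i\rceil)$ of the grid $\{0,\dots,n\}\times\mathbb N$ (node $\times$ time); put $t_0=0$. Three algorithms run together on $r_1,r_2,\dots$ * *Square* keeps a set $F$ of replicas, initially $\{(0,0)\}$. For $r_i$ it (1) adds $(0,s)$ for $t_{i-1}\le s\le t_i$; (2) lets $\rho_i=\min\max\{v_i-u,\,t_i-s\}$ over the $(u,s)\in F$ with $u\le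 v_i$, $s\le t_i$; (3) chooses $(u_i,s_i)\in F\cap([v_i-5\rho_i,v_i]\times[t_i-5\rho_i,t_i])$ with $u_i$ smallest possible; (4) adds the vertical path from $(u_i,s_i)$ to $(u_i,t_i)$, the base $\{(u,t_i):u_i\le u\le v_i\}$ and the tail $\{(u_i,t):t_i\le t\le t_i+4\rho_i\}$. * *The online grid algorithm* keeps the set $C_t$ of nodes whose copy has been stored until time $t$, with $C_0=\{0\}$. Delivery of $r_i$: let $w_i$ be the largest node $w\le u_i$ that has a copy at time $t_i$, that is, lies in $C_{t_i}$ or on an earlier delivery path of time $t_i$; deliver along the path $w_i,w_i+1,\dots,v_i$ at time $t_i$. Storage from $t$ to $t+1$, after the deliveries of time $t$: $C_{t+1}$ starts as $\{0\}$ together with the nodes $u$ such that $(u,t)$ lies in a tail. Then for $l=0,\dots,\lceil\log_\delta n\rceil$ in increasing order, and for $v=0,\dots,n$ in increasing order, let $B_l(v)$ be the set of the nodes $u\le v$ with $\lfloor u/\delta^l\rfloor\in\{\lfloor v/\delta^l\rfloor,\lfloor v/\delta^l\rfloor-1\}$; if $v$ has a base or tail replica at one of the times $t-\delta^l+1,\dots,t$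 and $C_{t+1}\cap B_l(v)=\emptyset$, choose a node $u\in B_l(v)$ that lies in $C_t$ or has a base replica at time $t$, and put $u$ into $C_{t+1}$. * *Drawing.* When $p_i$ arrives: for each $t=t_{i-1},\dots,t_i-1$ add the vertical segment from $(v,t)$ to $(v,t+1)$ for every $v\in C_{t+1}$; then add the horizontal segments from $(w_i,y_i)$ to $(v_i,y_i)$ and from $(v_i,y_i)$ to $(x_i,y_i)$, and the vertical segments from $(k,y_i)$ to $(k,t_i)$ for $w_i\le k\le v_i$. Let $\mathrm{ALG}_n(Q)$ be the cost of the solution drawn for $Q$; all choices left open above may be made arbitrarily. **Lemma.** There is an absolute constant $c>0$ such that for every integer $n\ge3$ the algorithm obeys the rules of the online model, and for every input $Q$ with $N\le n$ and $x_{\max}(Q)\le n$ the solution it draws is feasible and $$\mathrm{ALG}_n(Q)\le c\,\frac{\log n}{\log\log n}\,\bigl(\mathrm{OPT}(Q)+n\bigr).$$ If in addition $N\ge3$, $n^{1/4}\le N$ and $n/2\le x_{\max}(Q)$, then $$\mathrm{ALG}_n(Q)\le c\,\frac{\log N}{\log\log N}\,\mathrm{OPT}(Q),$$ that is, under these assumptions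 the algorithm is $O(\log N/\log\log N)$-competitive for RSA. -/

import Mathlib

namespace RSA

/-! ## The rectilinear Steiner arborescence problem -/

/-- A rectilinear line segment in the plane: `vert x y₁ y₂` joins `(x, y₁)` and `(x, y₂)`,
`horiz y x₁ x₂` joins `(x₁, y)` and `(x₂, y)`. -/
inductive Seg where
  | vert (x y₁ y₂ : ℝ) : Seg
  | horiz (y x₁ x₂ : ℝ) : Seg

noncomputable instance : DecidableEq Seg := Classical.decEq _

/-- The length of a segment. -/
def Seg.length : Seg → ℝ
  | .vert _ y₁ y₂ => |y₂ - y₁|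
  | .horiz _ x₁ x₂ => |x₂ - x₁|

/-- The set of points of a segment. -/
def Seg.carrier : Seg → Set (ℝ × ℝ)
  | .vert x y₁ y₂ => {p | p.1 = x ∧ p.2 ∈ Set.uIcc y₁ y₂}
  | .horiz y x₁ x₂ => {p | p.2 = y ∧ p.1 ∈ Set.uIcc x₁ x₂}

/-- The cost of a set of segments: the sum of the lengths of all its segments. -/
def cost (S : Finset Seg) : ℝ := ∑ s ∈ S, s.length

/-- One move of an `x`-monotone and `y`-monotone rectilinear path inside the segments of `S`:
straight to the right or straight up, along points covered by `S`. -/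
def MonoStep (S : Finset Seg) (a b : ℝ × ℝ) : Prop :=
  ((a.1 = b.1 ∧ a.2 ≤ b.2) ∨ (a.2 = b.2 ∧ a.1 ≤ b.1)) ∧
    segment ℝ a b ⊆ ⋃ s ∈ S, s.carrier

/-- An online input: points of the (closed) positive quadrant, given in an order in which their
`y`-coordinates do not decrease. -/
def IsInput (Q : List (ℝ × ℝ)) : Prop :=
  (∀ p ∈ Q, 0 ≤ p.1 ∧ 0 ≤ p.2) ∧ Q.Pairwise (fun p q => p.2 ≤ q.2)

/-- `S` is a feasible solution for the terminals `Q`: every terminal is reached from the origin by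
a rectilinear path inside `S` that is both `x`-monotone and `y`-monotone. -/
def Feasible (Q : List (ℝ × ℝ)) (S : Finset Seg) : Prop :=
  ∀ p ∈ Q, Relation.ReflTransGen (MonoStep S) (0, 0) p

/-- The cost of an optimal solution. -/
noncomputable def optCost (Q : List (ℝ × ℝ)) : ℝ :=
  sInf (cost '' {S | Feasible Q S})

/-- The largest `x`-coordinate of the terminals. -/
noncomputable def xMax (Q : List (ℝ × ℝ)) : ℝ := (Q.map Prod.fst).foldr max 0

/-- `A` obeys the rules of the online model: handling a new point `p` only adds segments, and the
added segments lie in the region from the `y`-coordinate of the previous point upwards. -/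
def IsOnline (A : List (ℝ × ℝ) → Finset Seg) : Prop :=
  ∀ (Q : List (ℝ × ℝ)) (p : ℝ × ℝ), IsInput (Q ++ [p]) →
    A Q ⊆ A (Q ++ [p]) ∧
    ∀ s ∈ A (Q ++ [p]), s ∉ A Q → ∀ z ∈ s.carrier, 0 ≤ z.2 ∧ ∀ q ∈ Q, q.2 ≤ z.2

/-! ## The network × time grid

A replica `(v, t)` is a pair of a network node `v` and a time `t`. -/

/-- The replicas of the vertical path from `(v, s)` to `(v, t)`. -/
def column (v s t : ℕ) : Finset (ℕ × ℕ) := {v} ×ˢ Finset.Icc s t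

/-- The replicas of the horizontal path from `(u, t)` to `(v, t)`. -/
def row (t u v : ℕ) : Finset (ℕ × ℕ) := Finset.Icc u v ×ˢ {t}

/-- The rectangle `[v - ρ, v] × [t - ρ, t]` with top right corner `r = (v, t)`
(truncated subtraction cuts it off at the boundary of the grid). -/
def rect (r : ℕ × ℕ) (ρ : ℕ) : Finset (ℕ × ℕ) :=
  Finset.Icc (r.1 - ρ) r.1 ×ˢ Finset.Icc (r.2 - ρ) r.2

/-- A resolution of the choices that the algorithms leave open: which replica of the serving node
serves the `i`-th request, and which of the possible nodes is stored for node `v` at level `l`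
from time `t` on. The last argument is the set of the admissible options. -/
structure Choices where
  serve : ℕ → Finset ℕ → ℕ
  store : ℕ → ℕ → ℕ → Finset ℕ → ℕ
  serve_mem : ∀ i S, S.Nonempty → serve i S ∈ S
  store_mem : ∀ t l v S, S.Nonempty → store t l v S ∈ S

/-! ## The pseudo-online algorithm Square -/

/-- The state of Square: number and time of the requests handled so far, the replicas of the
solution, and the base and tail replicas. -/
structure SqState where
  count : ℕ
  time : ℕ
  soln : Finset (ℕ × ℕ)
  base : Finset (ℕ × ℕ)
  tail : Finset (ℕ × ℕ)

/-- Before the first request the solution consists of the origin. -/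
def SqState.init : SqState := ⟨0, 0, {(0, 0)}, ∅, ∅⟩

/-- The distance, in the directed `L∞` sense, of `r` from the closest replica of `F`. -/
noncomputable def radius (F : Finset (ℕ × ℕ)) (r : ℕ × ℕ) : ℕ :=
  sInf {d | ∃ q ∈ F, q ≤ r ∧ d = max (r.1 - q.1) (r.2 - q.2)}

/-- The solution after the vertical path of node `0` has been extended to the time of `r`. -/
def SqState.extended (σ : SqState) (r : ℕ × ℕ) : Finset (ℕ × ℕ) :=
  σ.soln ∪ column 0 σ.time r.2

/-- The radius of the request `r`. -/
noncomputable def SqState.rad (σ : SqState) (r : ℕ × ℕ) : ℕ := radius (σ.extended r) r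

/-- The serving node of `r`: the leftmost node with a replica of the solution in the rectangle
of `r` of five times its radius. -/
noncomputable def SqState.servNode (σ : SqState) (r : ℕ × ℕ) : ℕ :=
  sInf {u | ∃ s, (u, s) ∈ rect r (5 * σ.rad r) ∩ σ.extended r}

/-- The time of the serving replica of `r`. -/
noncomputable def SqState.servTime (ch : Choices) (σ : SqState) (r : ℕ × ℕ) : ℕ :=
  ch.serve σ.count
    (((rect r (5 * σ.rad r) ∩ σ.extended r).filter (fun q => q.1 = σ.servNode r)).image Prod.snd)

/-- Square handles the request `r`: it serves `r` from the serving replica by going first up and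
then right, and leaves a tail of four times the radius at the serving node. -/
noncomputable def SqState.handle (ch : Choices) (σ : SqState) (r : ℕ × ℕ) : SqState where
  count := σ.count + 1
  time := r.2
  soln := σ.extended r ∪ column (σ.servNode r) (σ.servTime ch r) r.2 ∪
    row r.2 (σ.servNode r) r.1 ∪ column (σ.servNode r) r.2 (r.2 + 4 * σ.rad r)
  base := σ.base ∪ row r.2 (σ.servNode r) r.1
  tail := σ.tail ∪ column (σ.servNode r) r.2 (r.2 + 4 * σ.rad r)

/-! ## The online algorithm on the directed line with nodes `0, …, n` -/

/-- The nodes that are not to the right of `v` and belong to the level-`l` interval of `v` or to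
the interval just left of it; the level-`l` intervals are `{j * δ ^ l, …, (j + 1) * δ ^ l - 1}`. -/
def nbhd (δ l v : ℕ) : Finset ℕ :=
  (Finset.range (v + 1)).filter
    (fun u => u / δ ^ l = v / δ ^ l ∨ u / δ ^ l + 1 = v / δ ^ l)

/-- Node `v` is stay-active at level `l` and time `t`: it has a base or tail replica at one of the
times `t - δ ^ l + 1, …, t`. -/
def StayActive (σ : SqState) (δ l v t : ℕ) : Prop :=
  ∃ s, (v, s) ∈ σ.base ∪ σ.tail ∧ s ≤ t ∧ t < s + δ ^ l

/-- The state of the online algorithm: the simulated Square, the current time, the set of nodes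
whose copy was stored up to the current time, and the set of nodes that have a copy now. -/
structure OnState where
  sq : SqState
  time : ℕ
  cache : Finset ℕ
  avail : Finset ℕ

/-- At time `0` only the origin has a copy. -/
def OnState.init : OnState := ⟨SqState.init, 0, {0}, {0}⟩

open Classical in
/-- Treatment of node `v` at level `l` in the storage phase, `C` being the set of nodes selected so
far: if `v` is stay-active and no node of its neighbourhood has been selected, select a node of
the neighbourhood that has a base replica now or whose copy was stored up to now. -/
noncomputable def OnState.select (ch : Choices) (δ : ℕ) (d : OnState) (l : ℕ) (C : Finset ℕ)
    (v : ℕ) : Finset ℕ :=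
  if StayActive d.sq δ l v d.time ∧ Disjoint C (nbhd δ l v) then
    insert (ch.store d.time l v ((nbhd δ l v).filter
      (fun u => (u, d.time) ∈ d.sq.base ∨ u ∈ d.cache))) C
  else C

/-- The nodes that store a copy from the current time to the next: the origin, the nodes of the
current tail replicas, and those selected when the levels `0, …, ⌈log_δ n⌉` and, within a level,
the nodes are gone through in increasing order. -/
noncomputable def OnState.stored (ch : Choices) (δ n : ℕ) (d : OnState) : Finset ℕ :=
  (List.range (Nat.clog δ n + 1)).foldl
    (fun C l => (List.range (n + 1)).foldl (d.select ch δ l) C)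
    ({0} ∪ (d.sq.tail.filter (fun q => q.2 = d.time)).image Prod.fst)

/-- The storage phase: time passes by one unit. -/
noncomputable def OnState.tick (ch : Choices) (δ n : ℕ) (d : OnState) : OnState where
  sq := d.sq
  time := d.time + 1
  cache := d.stored ch δ n
  avail := d.stored ch δ n

/-- The node from which the online algorithm serves `r`: the closest node with a copy that is not
to the right of the serving node of Square. -/
noncomputable def OnState.source (d : OnState) (r : ℕ × ℕ) : ℕ :=
  (d.avail.filter (fun u => u ≤ d.sq.servNode r)).sup id

/-- The delivery phase for the request `r`. -/
noncomputable def OnState.deliver (ch : Choices) (d : OnState) (r : ℕ × ℕ) : OnState where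
  sq := d.sq.handle ch r
  time := d.time
  cache := d.cache
  avail := d.avail ∪ Finset.Icc (d.source r) r.1

/-! ## The grid-rounding algorithm for rectilinear Steiner arborescences -/

/-- The state: the simulated online algorithm on the grid and the segments drawn so far. -/
structure GridState where
  on : OnState
  segs : Finset Seg

/-- At the start nothing has been drawn. -/
def GridState.init : GridState := ⟨OnState.init, ∅⟩

/-- The parameter `δ = ⌈log n / log log n⌉`. -/
noncomputable def delta (n : ℕ) : ℕ := ⌈Real.log n / Real.log (Real.log n)⌉₊

/-- The grid replica of a point: the left top corner of its grid square. -/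
noncomputable def gridPoint (p : ℝ × ℝ) : ℕ × ℕ := (⌊p.1⌋₊, ⌈p.2⌉₊)

/-- One time unit of the vertical phase: copies that are stored become unit vertical segments. -/
noncomputable def GridState.tick (ch : Choices) (n : ℕ) (g : GridState) : GridState where
  on := g.on.tick ch (delta n) n
  segs := g.segs ∪ (g.on.tick ch (delta n) n).cache.image
    (fun v : ℕ => Seg.vert v g.on.time (g.on.time + 1))

/-- The horizontal phase for the point `p`: the delivery path of the grid algorithm is drawn at
height `p.2` and extended to `p`; every node of the path is joined upwards to the grid. -/
noncomputable def GridState.draw (ch : Choices) (g : GridState) (p : ℝ × ℝ) : GridState where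
  on := g.on.deliver ch (gridPoint p)
  segs := g.segs ∪
    {Seg.horiz p.2 (g.on.source (gridPoint p)) (gridPoint p).1,
      Seg.horiz p.2 (gridPoint p).1 p.1} ∪
    (Finset.Icc (g.on.source (gridPoint p)) (gridPoint p).1).image
      (fun k : ℕ => Seg.vert k p.2 (gridPoint p).2)

/-- The algorithm handles the point `p`: vertical phase up to the time of the grid replica of `p`,
then horizontal phase. -/
noncomputable def GridState.handle (ch : Choices) (n : ℕ) (g : GridState) (p : ℝ × ℝ) :
    GridState :=
  ((GridState.tick ch n)^[(gridPoint p).2 - g.on.time] g).draw ch p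

/-- The solution that the grid-rounding algorithm with parameter `n` draws for the points `Q`. -/
noncomputable def gridAlg (ch : Choices) (n : ℕ) (Q : List (ℝ × ℝ)) : Finset Seg :=
  (Q.foldl (GridState.handle ch n) GridState.init).segs

end RSA

/-!
The proof compares the drawing with the radii `ρ i` of Square, and these with the optimum.

*The radii of Square.* The square of side `ρ i` with top right corner `r i` (without its left and
bottom sides) contains no replica that Square has reached, so an optimal solution has length about
`ρ i` inside it (`sum_rad_le_cost`; for a solution in the plane this is seen from the level sets of
the directed `L∞` distance from the bottom left corner, all of which a monotone path has to cross).
If the squares were disjoint, the sum of the radii would be bounded by the optimum. The square of a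
request that is served from outside of its own square meets no later one. Otherwise a later request
`j` whose square meets that of `i` *undercuts* `i`: it lies to the left of the serving node of `i`.
The rule of taking the leftmost serving node within `5 ρ i` makes this expensive, namely
`4 * ρ i ≤ ρ j` (`IsSquareRun.four_mul_le`), and the tails of length `4 ρ` force the requests that
are undercut first by `j` to be far apart in time (`IsSquareRun.add_le_of_undercuts`). Hence their
radii sum up to at most `ρ j / 2`, and a constant part of the sum of all radii belongs to
requests with disjoint squares (`IsSquareRun.exists_disjointBoxes`).

*Deliveries.* Square has touched the serving node of `r i` at most `5 ρ i` time units ago, so at the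
first level `l` with `5 ρ i < δ ^ l` a copy is stored at distance less than `2 δ ^ l`; a delivery
costs `O(δ ρ i)` (`OnState.Valid.servNode_le`). That a copy to store can always be found is part of
the invariant `OnState.Valid`.

*Storage.* At a level with intervals of length `D` at most one node is selected at a time in each
interval, and only while the interval is active, which is the case for less than `D` time units
after a base or tail replica. So one has to count the `D × D` blocks with such replicas. The
solution of Square is an arborescence, hence a replica off the first column of blocks has `D`
ancestors within distance `D`, and a block is paid for by the replicas in its neighbourhood
(`SqState.Valid.sum_card_activeIntervals_le`). Every level therefore costs a constant times the size
of the solution of Square, and there are `O(log n / log log n)` levels (`clog_delta_le`).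

*The drawing.* A node with a copy is reached at all heights of the current time unit that are not
below the last point (`GridState.Valid`), which gives feasibility; rounding costs `O(1)` per point.
Under the additional assumptions the optimum is at least `n / 2`, which absorbs the additive `n`,
and `log n ≤ 4 * log N`.
-/

namespace RSA

/-! ### Runs of the algorithms as sequences of states -/

/-- The states of a machine with transition function `f` that is started in `x₀` and fed with the
letters `p 0, p 1, …`. -/
def seqRun {σ α : Type*} (f : σ → α → σ) (x₀ : σ) (p : ℕ → α) : ℕ → σ
  | 0 => x₀
  | i + 1 => f (seqRun f x₀ p i) (p i)

theorem seqRun_congr {σ α : Type*} (f : σ → α → σ) (x₀ : σ) {p q : ℕ → α} {N : ℕ}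
    (h : ∀ i < N, p i = q i) : seqRun f x₀ p N = seqRun f x₀ q N := by
  induction N with
  | zero => rfl
  | succ k ih =>
    simp only [seqRun]
    rw [ih (fun i hi => h i (by omega)), h k (by omega)]

theorem foldl_eq_seqRun {σ α : Type*} (f : σ → α → σ) (x₀ : σ) (d : α) (Q : List α) :
    Q.foldl f x₀ = seqRun f x₀ (fun i => Q.getD i d) Q.length := by
  induction Q using List.reverseRecOn with
  | nil => rfl
  | append_singleton Q a ih =>
    rw [List.foldl_append, List.length_append]
    simp only [List.foldl_cons, List.foldl_nil, List.length_singleton, seqRun]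
    rw [ih]
    congr 1
    · apply seqRun_congr
      intro i hi
      simp [List.getElem?_append_left hi]
    · simp

/-! ### Square: membership and invariants -/

theorem mem_column {x y v s t : ℕ} : (x, y) ∈ column v s t ↔ x = v ∧ s ≤ y ∧ y ≤ t := by
  simp only [column, Finset.mem_product, Finset.mem_singleton, Finset.mem_Icc]

theorem mem_row {x y t u v : ℕ} : (x, y) ∈ row t u v ↔ u ≤ x ∧ x ≤ v ∧ y = t := by
  simp only [row, Finset.mem_product, Finset.mem_singleton, Finset.mem_Icc, and_assoc]

theorem mem_rect {x y : ℕ} {r : ℕ × ℕ} {d : ℕ} :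
    (x, y) ∈ rect r d ↔ x ≤ r.1 ∧ r.1 ≤ x + d ∧ y ≤ r.2 ∧ r.2 ≤ y + d := by
  simp only [rect, Finset.mem_product, Finset.mem_Icc]
  omega

/-- The invariants of Square on the nodes `0, …, n`. The field `pred` says that the solution is an
arborescence rooted at the origin, `desc` that the node of a replica in the future has replicas at
all times from now on until then, and `late` that the replicas of nodes other than `0` that belong
to no base and no tail lie below a base replica of their node. -/
structure SqState.Valid (n : ℕ) (σ : SqState) : Prop where
  zero : ∀ t ≤ σ.time, (0, t) ∈ σ.soln
  pred : ∀ x y, (x, y) ∈ σ.soln → (x = 0 ∧ y = 0) ∨ (∃ x', x = x' + 1 ∧ (x', y) ∈ σ.soln) ∨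
    (∃ y', y = y' + 1 ∧ (x, y') ∈ σ.soln)
  desc : ∀ x y t, (x, y) ∈ σ.soln → σ.time ≤ t → t ≤ y → (x, t) ∈ σ.soln
  late : ∀ x y, (x, y) ∈ σ.soln →
    x = 0 ∨ (x, y) ∈ σ.base ∪ σ.tail ∨ ∃ s, y ≤ s ∧ s ≤ σ.time ∧ (x, s) ∈ σ.base
  sub : σ.base ∪ σ.tail ⊆ σ.soln
  base_le : ∀ x y, (x, y) ∈ σ.base → y ≤ σ.time ∧ x ≤ n
  tail_start : ∀ x y, (x, y) ∈ σ.tail →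
    ∃ s, s ≤ y ∧ (x, s) ∈ σ.base ∧ ∀ t, s ≤ t → t ≤ y → (x, t) ∈ σ.tail

theorem SqState.valid_init (n : ℕ) : SqState.init.Valid n := by
  constructor <;> simp +contextual [SqState.init]

section handle
variable {n : ℕ} {σ : SqState} {r : ℕ × ℕ}

theorem SqState.mem_extended {x y : ℕ} :
    (x, y) ∈ σ.extended r ↔ (x, y) ∈ σ.soln ∨ (x = 0 ∧ σ.time ≤ y ∧ y ≤ r.2) := by
  simp [SqState.extended, mem_column]

theorem SqState.Valid.zero_mem_extended (h : σ.Valid n) {t : ℕ} (ht : t ≤ r.2) :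
    (0, t) ∈ σ.extended r := by
  rw [SqState.mem_extended]
  rcases le_total t σ.time with h1 | h1
  · exact Or.inl (h.zero t h1)
  · exact Or.inr ⟨rfl, h1, ht⟩

theorem SqState.rad_le {x y : ℕ} (hm : (x, y) ∈ σ.extended r) (hx : x ≤ r.1) (hy : y ≤ r.2) :
    σ.rad r ≤ max (r.1 - x) (r.2 - y) :=
  Nat.sInf_le ⟨(x, y), hm, Prod.mk_le_mk.2 ⟨hx, hy⟩, rfl⟩

/-- The part of the square of side `σ.rad r` below and to the left of `r` without its left and
bottom sides contains no replica of the solution. -/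
theorem SqState.not_mem_extended {x y : ℕ} (hx : x ≤ r.1) (hy : y ≤ r.2)
    (hx' : r.1 < x + σ.rad r) (hy' : r.2 < y + σ.rad r) : (x, y) ∉ σ.extended r := by
  intro hm
  have := SqState.rad_le hm hx hy
  rcases le_total (r.1 - x) (r.2 - y) with h | h
  · rw [max_eq_right h] at this; omega
  · rw [max_eq_left h] at this; omega

theorem SqState.Valid.exists_rad (h : σ.Valid n) (r : ℕ × ℕ) :
    ∃ x y, (x, y) ∈ σ.extended r ∧ x ≤ r.1 ∧ y ≤ r.2 ∧ σ.rad r = max (r.1 - x) (r.2 - y) := by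
  have hne : {d | ∃ q ∈ σ.extended r, q ≤ r ∧ d = max (r.1 - q.1) (r.2 - q.2)}.Nonempty :=
    ⟨_, (0, r.2), h.zero_mem_extended le_rfl, Prod.mk_le_mk.2 ⟨Nat.zero_le _, le_rfl⟩, rfl⟩
  obtain ⟨⟨x, y⟩, h1, h2, h3⟩ := Nat.sInf_mem hne
  exact ⟨x, y, h1, (Prod.le_def.1 h2).1, (Prod.le_def.1 h2).2, h3⟩

theorem SqState.Valid.rad_le_fst (h : σ.Valid n) (r : ℕ × ℕ) : σ.rad r ≤ r.1 := by
  have := SqState.rad_le (h.zero_mem_extended (r := r) le_rfl) (Nat.zero_le _) le_rfl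
  simpa using this

theorem SqState.Valid.servNode_mem (h : σ.Valid n) (r : ℕ × ℕ) :
    ∃ s, (σ.servNode r, s) ∈ rect r (5 * σ.rad r) ∩ σ.extended r := by
  have hne : {u | ∃ s, (u, s) ∈ rect r (5 * σ.rad r) ∩ σ.extended r}.Nonempty := by
    obtain ⟨x, y, hm, hx, hy, hd⟩ := h.exists_rad r
    refine ⟨x, y, Finset.mem_inter.2 ⟨mem_rect.2 ?_, hm⟩⟩
    have := le_max_left (r.1 - x) (r.2 - y)
    have := le_max_right (r.1 - x) (r.2 - y)
    omega
  exact Nat.sInf_mem hne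

theorem SqState.servNode_le {x y : ℕ} (hm : (x, y) ∈ σ.extended r) (hx : x ≤ r.1) (hy : y ≤ r.2)
    (hx' : r.1 ≤ x + 5 * σ.rad r) (hy' : r.2 ≤ y + 5 * σ.rad r) : σ.servNode r ≤ x :=
  Nat.sInf_le ⟨y, Finset.mem_inter.2 ⟨mem_rect.2 ⟨hx, hx', hy, hy'⟩, hm⟩⟩

theorem SqState.Valid.serv_mem (h : σ.Valid n) (ch : Choices) (r : ℕ × ℕ) :
    (σ.servNode r, σ.servTime ch r) ∈ rect r (5 * σ.rad r) ∩ σ.extended r := by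
  have hne : (((rect r (5 * σ.rad r) ∩ σ.extended r).filter
      (fun q => q.1 = σ.servNode r)).image Prod.snd).Nonempty := by
    obtain ⟨s, hs⟩ := h.servNode_mem r
    exact ⟨s, Finset.mem_image.2 ⟨_, Finset.mem_filter.2 ⟨hs, rfl⟩, rfl⟩⟩
  have := ch.serve_mem σ.count _ hne
  obtain ⟨⟨x, y⟩, hq, hq'⟩ := Finset.mem_image.1 this
  obtain ⟨h1, h2⟩ := Finset.mem_filter.1 hq
  simp only at h2 hq'
  rw [h2] at h1
  rw [hq'] at h1
  exact h1

theorem SqState.Valid.serv_bounds (h : σ.Valid n) (ch : Choices) (r : ℕ × ℕ) :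
    σ.servNode r ≤ r.1 ∧ r.1 ≤ σ.servNode r + 5 * σ.rad r ∧ σ.servTime ch r ≤ r.2 ∧
      r.2 ≤ σ.servTime ch r + 5 * σ.rad r :=
  mem_rect.1 (Finset.mem_inter.1 (h.serv_mem ch r)).1

/-- The replicas that Square adds for the request `r` when it serves it. -/
noncomputable def SqState.added (ch : Choices) (σ : SqState) (r : ℕ × ℕ) : Finset (ℕ × ℕ) :=
  column (σ.servNode r) (σ.servTime ch r) r.2 ∪ row r.2 (σ.servNode r) r.1 ∪
    column (σ.servNode r) r.2 (r.2 + 4 * σ.rad r)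

theorem SqState.mem_added {ch : Choices} {x y : ℕ} : (x, y) ∈ σ.added ch r ↔
    (x = σ.servNode r ∧ σ.servTime ch r ≤ y ∧ y ≤ r.2) ∨
    (σ.servNode r ≤ x ∧ x ≤ r.1 ∧ y = r.2) ∨
    (x = σ.servNode r ∧ r.2 ≤ y ∧ y ≤ r.2 + 4 * σ.rad r) := by
  simp [SqState.added, mem_column, mem_row]

theorem SqState.handle_soln (ch : Choices) :
    (σ.handle ch r).soln = σ.extended r ∪ σ.added ch r := by
  simp [SqState.handle, SqState.added, Finset.union_assoc]

theorem SqState.mem_handle_soln {ch : Choices} {x y : ℕ} : (x, y) ∈ (σ.handle ch r).soln ↔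
    (x, y) ∈ σ.extended r ∨ (x, y) ∈ σ.added ch r := by
  rw [SqState.handle_soln, Finset.mem_union]

theorem SqState.mem_handle_base {ch : Choices} {x y : ℕ} : (x, y) ∈ (σ.handle ch r).base ↔
    (x, y) ∈ σ.base ∨ (σ.servNode r ≤ x ∧ x ≤ r.1 ∧ y = r.2) := by
  simp [SqState.handle, mem_row]

theorem SqState.mem_handle_tail {ch : Choices} {x y : ℕ} : (x, y) ∈ (σ.handle ch r).tail ↔
    (x, y) ∈ σ.tail ∨ (x = σ.servNode r ∧ r.2 ≤ y ∧ y ≤ r.2 + 4 * σ.rad r) := by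
  simp [SqState.handle, mem_column]

theorem SqState.Valid.desc_extended (h : σ.Valid n) (hr : σ.time ≤ r.2) {x y t : ℕ}
    (hm : (x, y) ∈ σ.extended r) (h1 : r.2 ≤ t) (h2 : t ≤ y) : (x, t) ∈ σ.extended r := by
  rw [SqState.mem_extended] at hm ⊢
  rcases hm with hm | ⟨rfl, h3, h4⟩
  · exact Or.inl (h.desc x y t hm (by omega) h2)
  · exact Or.inr ⟨rfl, by omega, by omega⟩

theorem SqState.Valid.handle (h : σ.Valid n) (ch : Choices) (hr : σ.time ≤ r.2) (hn : r.1 ≤ n) :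
    (σ.handle ch r).Valid n := by
  obtain ⟨b1, b2, b3, b4⟩ := h.serv_bounds ch r
  have hs := (Finset.mem_inter.1 (h.serv_mem ch r)).2
  have htime : (σ.handle ch r).time = r.2 := rfl
  constructor
  · intro t ht
    rw [SqState.mem_handle_soln]
    exact Or.inl (h.zero_mem_extended ht)
  · intro x y hm
    simp only [SqState.mem_handle_soln] at hm ⊢
    rcases hm with hm | hm
    · rw [SqState.mem_extended] at hm
      rcases hm with hm | ⟨rfl, h3, h4⟩
      · rcases h.pred x y hm with hh | ⟨x', e, hh⟩ | ⟨y', e, hh⟩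
        · exact Or.inl hh
        · exact Or.inr (Or.inl ⟨x', e, Or.inl (SqState.mem_extended.2 (Or.inl hh))⟩)
        · exact Or.inr (Or.inr ⟨y', e, Or.inl (SqState.mem_extended.2 (Or.inl hh))⟩)
      · rcases y with _ | y
        · exact Or.inl ⟨rfl, rfl⟩
        · exact Or.inr (Or.inr ⟨y, rfl, Or.inl (h.zero_mem_extended (by omega))⟩)
    · -- the serving replica already belongs to an arborescence, hence has a predecessor
      have hserv : σ.servNode r = 0 ∧ σ.servTime ch r = 0 ∨
          (∃ x', σ.servNode r = x' + 1 ∧ (x', σ.servTime ch r) ∈ σ.extended r) ∨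
          (∃ y', σ.servTime ch r = y' + 1 ∧ (σ.servNode r, y') ∈ σ.extended r) := by
        have hs' := SqState.mem_extended.1 hs
        rcases hs' with hs' | ⟨e, h3, h4⟩
        · rcases h.pred _ _ hs' with hh | ⟨x', e, hh⟩ | ⟨y', e, hh⟩
          · exact Or.inl hh
          · exact Or.inr (Or.inl ⟨x', e, SqState.mem_extended.2 (Or.inl hh)⟩)
          · exact Or.inr (Or.inr ⟨y', e, SqState.mem_extended.2 (Or.inl hh)⟩)
        · rcases hz : σ.servTime ch r with _ | y
          · exact Or.inl ⟨e, rfl⟩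
          · refine Or.inr (Or.inr ⟨y, rfl, ?_⟩)
            rw [e]; exact h.zero_mem_extended (by omega)
      have hcol : ∀ y, σ.servTime ch r ≤ y → y ≤ r.2 + 4 * σ.rad r →
          (σ.servNode r, y) ∈ σ.added ch r := by
        intro y h1 h2
        rw [SqState.mem_added]
        by_cases h3 : y ≤ r.2
        · exact Or.inl ⟨rfl, h1, h3⟩
        · exact Or.inr (Or.inr ⟨rfl, by omega, h2⟩)
      have key : ∀ y, σ.servTime ch r ≤ y → y ≤ r.2 + 4 * σ.rad r →
          (σ.servNode r = 0 ∧ y = 0) ∨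
          (∃ x', σ.servNode r = x' + 1 ∧ ((x', y) ∈ σ.extended r ∨ (x', y) ∈ σ.added ch r)) ∨
          (∃ y', y = y' + 1 ∧ ((σ.servNode r, y') ∈ σ.extended r ∨
            (σ.servNode r, y') ∈ σ.added ch r)) := by
        intro y h1 h2
        rcases h1.eq_or_lt with h1 | h1
        · subst h1
          rcases hserv with hh | ⟨x', e, hh⟩ | ⟨y', e, hh⟩
          · exact Or.inl hh
          · exact Or.inr (Or.inl ⟨x', e, Or.inl hh⟩)
          · exact Or.inr (Or.inr ⟨y', e, Or.inl hh⟩)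
        · obtain ⟨y', rfl⟩ : ∃ y', y = y' + 1 := ⟨y - 1, by omega⟩
          exact Or.inr (Or.inr ⟨y', rfl, Or.inr (hcol y' (by omega) (by omega))⟩)
      rcases SqState.mem_added.1 hm with ⟨rfl, h1, h2⟩ | ⟨h1, h2, rfl⟩ | ⟨rfl, h1, h2⟩
      · exact key y h1 (by omega)
      · rcases h1.eq_or_lt with h1 | h1
        · subst h1
          exact key r.2 b3 (by omega)
        · obtain ⟨x', rfl⟩ : ∃ x', x = x' + 1 := ⟨x - 1, by omega⟩
          refine Or.inr (Or.inl ⟨x', rfl, Or.inr (SqState.mem_added.2 (Or.inr (Or.inl ?_)))⟩)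
          exact ⟨by omega, by omega, rfl⟩
      · exact key y (by omega) h2
  · intro x y t hm h1 h2
    rw [SqState.mem_handle_soln] at hm ⊢
    rw [htime] at h1
    rcases hm with hm | hm
    · exact Or.inl (h.desc_extended hr hm h1 h2)
    · right
      rw [SqState.mem_added] at hm ⊢
      omega
  · intro x y hm
    rw [SqState.mem_handle_soln, SqState.mem_extended] at hm
    simp only [Finset.mem_union, SqState.mem_handle_base, SqState.mem_handle_tail, htime]
    rcases hm with (hm | hm) | hm
    · rcases h.late x y hm with h1 | h1 | ⟨s, h1, h2, h3⟩
      · exact Or.inl h1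
      · rw [Finset.mem_union] at h1
        tauto
      · exact Or.inr (Or.inr ⟨s, h1, by omega, Or.inl h3⟩)
    · exact Or.inl hm.1
    · rcases SqState.mem_added.1 hm with ⟨rfl, h1, h2⟩ | h1 | h1
      · exact Or.inr (Or.inr ⟨r.2, h2, le_rfl, Or.inr ⟨le_rfl, b1, rfl⟩⟩)
      · tauto
      · tauto
  · rintro ⟨x, y⟩ hm
    rw [SqState.mem_handle_soln, SqState.mem_extended, SqState.mem_added]
    simp only [Finset.mem_union, SqState.mem_handle_base, SqState.mem_handle_tail] at hm
    rcases hm with (hm | hm) | (hm | hm)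
    · exact Or.inl (Or.inl (h.sub (Finset.mem_union_left _ hm)))
    · tauto
    · exact Or.inl (Or.inl (h.sub (Finset.mem_union_right _ hm)))
    · tauto
  · intro x y hm
    rw [SqState.mem_handle_base] at hm
    rw [htime]
    rcases hm with hm | hm
    · have := h.base_le x y hm
      omega
    · omega
  · intro x y hm
    simp only [SqState.mem_handle_base, SqState.mem_handle_tail] at hm ⊢
    rcases hm with hm | ⟨rfl, h1, h2⟩
    · obtain ⟨s, h1, h2, h3⟩ := h.tail_start x y hm
      exact ⟨s, h1, Or.inl h2, fun t h4 h5 => Or.inl (h3 t h4 h5)⟩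
    · exact ⟨r.2, h1, Or.inr ⟨le_rfl, b1, rfl⟩, fun t h4 h5 => Or.inr ⟨rfl, h4, by omega⟩⟩

theorem SqState.Valid.card_handle_soln_le (h : σ.Valid n) (ch : Choices) (hr : σ.time ≤ r.2) :
    (σ.handle ch r).soln.card + σ.time ≤ σ.soln.card + r.2 + 14 * σ.rad r + 3 := by
  obtain ⟨b1, b2, b3, b4⟩ := h.serv_bounds ch r
  have hc : ∀ v s t : ℕ, (column v s t).card = t + 1 - s := by simp [column]
  have hrow : (row r.2 (σ.servNode r) r.1).card = r.1 + 1 - σ.servNode r := by simp [row]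
  have hadd : (σ.added ch r).card ≤ 14 * σ.rad r + 3 := by
    have h1 := Finset.card_union_le (column (σ.servNode r) (σ.servTime ch r) r.2 ∪
      row r.2 (σ.servNode r) r.1) (column (σ.servNode r) r.2 (r.2 + 4 * σ.rad r))
    have h2 := Finset.card_union_le (column (σ.servNode r) (σ.servTime ch r) r.2)
      (row r.2 (σ.servNode r) r.1)
    rw [hc, hrow] at h2
    rw [hc] at h1
    unfold SqState.added
    omega
  -- the lowest replica of the new piece of the column of node `0` is not new
  have hext : (σ.extended r).card + σ.time ≤ σ.soln.card + r.2 := by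
    have : σ.extended r ⊆ σ.soln ∪ column 0 (σ.time + 1) r.2 := by
      rintro ⟨x, y⟩ hm
      rw [Finset.mem_union, mem_column]
      rcases SqState.mem_extended.1 hm with hm | ⟨rfl, h1, h2⟩
      · exact Or.inl hm
      · rcases h1.eq_or_lt with h1 | h1
        · exact Or.inl (h1 ▸ h.zero _ le_rfl)
        · exact Or.inr ⟨rfl, h1, h2⟩
    have h1 := Finset.card_le_card this
    have h2 := Finset.card_union_le σ.soln (column 0 (σ.time + 1) r.2)
    rw [hc] at h2
    omega
  have := Finset.card_union_le (σ.extended r) (σ.added ch r)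
  rw [SqState.handle_soln]
  omega

theorem SqState.card_handle_tail_le (ch : Choices) :
    (σ.handle ch r).tail.card ≤ σ.tail.card + 4 * σ.rad r + 1 := by
  have := Finset.card_union_le σ.tail (column (σ.servNode r) r.2 (r.2 + 4 * σ.rad r))
  have h2 : (column (σ.servNode r) r.2 (r.2 + 4 * σ.rad r)).card = 4 * σ.rad r + 1 := by
    simp [column]; omega
  simp only [SqState.handle]
  omega

end handle

/-! ### The run of Square on a sequence of requests -/

/-- The state of Square before the `i`-th request of the sequence `r` is handled. -/
noncomputable abbrev sqRun (ch : Choices) (r : ℕ → ℕ × ℕ) : ℕ → SqState :=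
  seqRun (SqState.handle ch) SqState.init r

/-- The first `N` requests concern the nodes `0, …, n` and come in the order of time. -/
structure IsRequests (n N : ℕ) (r : ℕ → ℕ × ℕ) : Prop where
  le : ∀ i < N, (r i).1 ≤ n
  mono : ∀ i j, i ≤ j → j < N → (r i).2 ≤ (r j).2

section run
variable {ch : Choices} {n N : ℕ} {r : ℕ → ℕ × ℕ}

theorem sqRun_time_le (h : IsRequests n N r) {i : ℕ} (hi : i < N) :
    (sqRun ch r i).time ≤ (r i).2 := by
  cases i with
  | zero => exact Nat.zero_le _
  | succ i => exact h.mono i (i + 1) (by omega) hi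

theorem sqRun_valid (h : IsRequests n N r) {i : ℕ} (hi : i ≤ N) : (sqRun ch r i).Valid n := by
  induction i with
  | zero => exact SqState.valid_init n
  | succ i ih =>
    exact (ih (by omega)).handle ch (sqRun_time_le h (by omega)) (h.le i (by omega))

theorem card_soln_sqRun_le (h : IsRequests n N r) {i : ℕ} (hi : i ≤ N) :
    (sqRun ch r i).soln.card ≤
      1 + (sqRun ch r i).time + 14 * ∑ k ∈ Finset.range i, (sqRun ch r k).rad (r k) + 3 * i := by
  induction i with
  | zero => simp [seqRun, SqState.init]
  | succ i ih =>
    have h1 := (sqRun_valid (ch := ch) h (i := i) (by omega)).card_handle_soln_le ch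
      (sqRun_time_le h (by omega))
    have h2 := ih (by omega)
    have h3 : (sqRun ch r (i + 1)).time = (r i).2 := rfl
    have h4 : sqRun ch r (i + 1) = (sqRun ch r i).handle ch (r i) := rfl
    rw [Finset.sum_range_succ, h3, h4]
    omega

theorem card_tail_sqRun_le (i : ℕ) :
    (sqRun ch r i).tail.card ≤ 4 * ∑ k ∈ Finset.range i, (sqRun ch r k).rad (r k) + i := by
  induction i with
  | zero => simp [seqRun, SqState.init]
  | succ i ih =>
    have h1 := SqState.card_handle_tail_le (σ := sqRun ch r i) (r := r i) ch
    have h4 : sqRun ch r (i + 1) = (sqRun ch r i).handle ch (r i) := rfl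
    rw [Finset.sum_range_succ, h4]
    omega

end run

/-! ### The radii of Square: charging to disjoint squares -/

/-- What the analysis of the radii uses about Square: the `i`-th request is `(v i, t i)`, its
radius is `ρ i`, it is served from `(u i, s i)`, and `F i` is the set of the replicas from which it
could be served. -/
structure IsSquareRun (N : ℕ) (v t ρ u s : ℕ → ℕ) (F : ℕ → ℕ → ℕ → Prop) : Prop where
  mono : ∀ {i j}, i ≤ j → j < N → t i ≤ t j
  serv : ∀ {i}, i < N →
    u i ≤ v i ∧ v i ≤ u i + 5 * ρ i ∧ s i ≤ t i ∧ t i ≤ s i + 5 * ρ i ∧ F i (u i) (s i)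
  empty : ∀ {i x y}, i < N → x ≤ v i → y ≤ t i → v i < x + ρ i → t i < y + ρ i → ¬ F i x y
  near : ∀ {i}, i < N → ∃ x y, F i x y ∧ x ≤ v i ∧ y ≤ t i ∧ v i ≤ x + ρ i ∧ t i ≤ y + ρ i ∧
    (v i = x + ρ i ∨ t i = y + ρ i)
  left : ∀ {i x y}, i < N → F i x y → x ≤ v i → y ≤ t i → v i ≤ x + 5 * ρ i →
    t i ≤ y + 5 * ρ i → u i ≤ x
  subset : ∀ {i j x y}, i ≤ j → j < N → F i x y → F j x y
  zero : ∀ {i y}, i < N → y ≤ t i → F i 0 y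
  desc : ∀ {i x y}, i < N → F i x y → t i ≤ y → F i x (t i)
  col : ∀ {i j y}, i < j → j < N → s i ≤ y → y ≤ t i + 4 * ρ i → F j (u i) y
  row : ∀ {i j x}, i < j → j < N → u i ≤ x → x ≤ v i → F j x (t i)
  new : ∀ {i j x y}, i ≤ j → j < N → F j x y → F i x y ∨ x = 0 ∨ ∃ k, i ≤ k ∧ k < j ∧
    ((x = u k ∧ s k ≤ y ∧ y ≤ t k + 4 * ρ k) ∨ (u k ≤ x ∧ x ≤ v k ∧ y = t k))

theorem isSquareRun_sqRun {ch : Choices} {n N : ℕ} {r : ℕ → ℕ × ℕ} (h : IsRequests n N r) :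
    IsSquareRun N (fun i => (r i).1) (fun i => (r i).2) (fun i => (sqRun ch r i).rad (r i))
      (fun i => (sqRun ch r i).servNode (r i)) (fun i => (sqRun ch r i).servTime ch (r i))
      (fun i x y => (x, y) ∈ (sqRun ch r i).extended (r i)) := by
  have hV : ∀ {i}, i < N → (sqRun ch r i).Valid n := fun hi => sqRun_valid h hi.le
  have hsucc : ∀ i, sqRun ch r (i + 1) = (sqRun ch r i).handle ch (r i) := fun _ => rfl
  have hstep : ∀ i x y, (x, y) ∈ (sqRun ch r i).extended (r i) ∨
      (x, y) ∈ (sqRun ch r i).added ch (r i) →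
      (x, y) ∈ (sqRun ch r (i + 1)).extended (r (i + 1)) := by
    intro i x y hm
    rw [SqState.mem_extended, hsucc, SqState.mem_handle_soln]
    exact Or.inl hm
  have hmono : ∀ i j, i ≤ j → ∀ x y, (x, y) ∈ (sqRun ch r i).extended (r i) →
      (x, y) ∈ (sqRun ch r j).extended (r j) := by
    intro i j hij x y hm
    induction j, hij using Nat.le_induction with
    | base => exact hm
    | succ j _ ih => exact hstep j x y (Or.inl ih)
  constructor
  · intro i j hij hj
    exact h.mono i j hij hj
  · intro i hi
    obtain ⟨b1, b2, b3, b4⟩ := (hV hi).serv_bounds ch (r i)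
    exact ⟨b1, b2, b3, b4, (Finset.mem_inter.1 ((hV hi).serv_mem ch (r i))).2⟩
  · intro i x y _ h1 h2 h3 h4
    exact SqState.not_mem_extended h1 h2 h3 h4
  · intro i hi
    obtain ⟨x, y, hm, hx, hy, hd⟩ := (hV hi).exists_rad (r i)
    refine ⟨x, y, hm, hx, hy, ?_⟩
    rcases le_total ((r i).1 - x) ((r i).2 - y) with hh | hh
    · rw [max_eq_right hh] at hd; omega
    · rw [max_eq_left hh] at hd; omega
  · intro i x y _ hm h1 h2 h3 h4
    exact SqState.servNode_le hm h1 h2 h3 h4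
  · intro i j x y hij _ hm
    exact hmono i j hij x y hm
  · intro i y hi hy
    exact (hV hi).zero_mem_extended hy
  · intro i x y hi hm hy
    exact (hV hi).desc_extended (sqRun_time_le h hi) hm le_rfl hy
  · intro i j y hij hj h1 h2
    refine hmono (i + 1) j hij _ _ (hstep i _ _ (Or.inr ?_))
    rw [SqState.mem_added]
    omega
  · intro i j x hij hj h1 h2
    refine hmono (i + 1) j hij _ _ (hstep i _ _ (Or.inr ?_))
    rw [SqState.mem_added]
    omega
  · intro i j x y hij hj hm
    induction j, hij using Nat.le_induction with
    | base => exact Or.inl hm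
    | succ j hij ih =>
      rw [SqState.mem_extended, hsucc, SqState.mem_handle_soln] at hm
      rcases hm with (hm | hm) | hm
      · rcases ih (by omega) hm with h1 | h1 | ⟨k, h1, h2, h3⟩
        · exact Or.inl h1
        · exact Or.inr (Or.inl h1)
        · exact Or.inr (Or.inr ⟨k, h1, by omega, h3⟩)
      · refine Or.inr (Or.inr ⟨j, hij, by omega, ?_⟩)
        rw [SqState.mem_added] at hm
        have := ((hV (i := j) (by omega)).serv_bounds ch (r j)).2.2.1
        omega
      · exact Or.inr (Or.inl hm.1)

namespace IsSquareRun

variable {N : ℕ} {v t ρ u s : ℕ → ℕ} {F : ℕ → ℕ → ℕ → Prop}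

/-- The square of the request `i`: the replicas at most `ρ i - 1` to the left of and below it. -/
def InBox (v t ρ : ℕ → ℕ) (i x y : ℕ) : Prop :=
  x ≤ v i ∧ y ≤ t i ∧ v i < x + ρ i ∧ t i < y + ρ i

/-- The later request `j` undercuts the request `i`: it lies to the left of the serving node of `i`
but not left of the square of `i`, and its own square reaches down to the time of `i`. -/
def Undercuts (v t ρ u : ℕ → ℕ) (i j : ℕ) : Prop :=
  v j < u i ∧ v i < v j + ρ i ∧ t j < t i + ρ j

/-- If the squares of two requests meet, the later one undercuts the earlier one: otherwise its
square would contain a replica of the base of the earlier one. -/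
theorem undercuts_of_inBox (h : IsSquareRun N v t ρ u s F) {i j x y : ℕ} (hij : i < j) (hj : j < N)
    (h1 : InBox v t ρ i x y) (h2 : InBox v t ρ j x y) : Undercuts v t ρ u i j := by
  obtain ⟨a1, a2, a3, a4⟩ := h1
  obtain ⟨b1, b2, b3, b4⟩ := h2
  have ht := h.mono hij.le hj
  have hs := h.serv (hij.trans hj)
  refine ⟨?_, by omega, by omega⟩
  by_contra hc
  rcases le_total (v i) (v j) with hv | hv
  · exact h.empty hj (x := v i) (y := t i) hv ht (by omega) (by omega)
      (h.row hij hj (by omega) le_rfl)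
  · exact h.empty hj (x := v j) (y := t i) le_rfl ht (by omega) (by omega)
      (h.row hij hj (by omega) hv)

/-- A request whose serving node is within its square has its closest replica at the bottom side of
the square. -/
theorem exists_below (h : IsSquareRun N v t ρ u s F) {b : ℕ} (hb : b < N)
    (hub : v b < u b + ρ b) :
    ∃ x y, F b x y ∧ x ≤ v b ∧ v b < x + ρ b ∧ t b = y + ρ b := by
  obtain ⟨x, y, hF, h1, h2, h3, h4, h5⟩ := h.near hb
  have := h.left hb hF h1 h2 (by omega) (by omega)
  exact ⟨x, y, hF, h1, by omega, by omega⟩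

/-- Undercutting is expensive: the replica closest to `b` was already there when `a` arrived, and
then it was too far away to serve `a`. -/
theorem four_mul_le (h : IsSquareRun N v t ρ u s F) {a b : ℕ} (hab : a < b) (hb : b < N)
    (hub : v b < u b + ρ b) (ho : Undercuts v t ρ u a b) :
    4 * ρ a ≤ ρ b := by
  obtain ⟨o1, o2, o3⟩ := ho
  have ha := hab.trans hb
  have ht := h.mono hab.le hb
  have hsa := h.serv ha
  obtain ⟨x, y, hF, h1, h2, h3⟩ := h.exists_below hb hub
  have hFa : F a x y := by
    rcases h.new hab.le hb hF with h4 | rfl | ⟨k, hak, hkb, h4 | h4⟩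
    · exact h4
    · exact h.zero ha (by omega)
    · -- the node of a new column has a base replica later on, which is at least as close
      exfalso
      have hk := h.mono hak (hkb.trans hb)
      have hk' := h.mono hkb.le hb
      have hsk := h.serv (hkb.trans hb)
      exact h.empty hb h1 hk' h2 (by omega) (h.row hkb hb (by omega) (by omega))
    · exfalso
      have hk := h.mono hak (hkb.trans hb)
      omega
  by_contra hc
  have := h.left ha hFa (by omega) (by omega) (by omega) (by omega)
  omega

/-- Two requests that are undercut by `b`, the earlier of which is not undercut by the later one,
are far apart in time: in between, the algorithm has left a tail that the square of the later one
has to avoid. -/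
theorem add_le_of_undercuts (h : IsSquareRun N v t ρ u s F) {a c b : ℕ} (hac : a < c) (hcb : c < b)
    (hb : b < N) (huc : v c < u c + ρ c) (hub : v b < u b + ρ b)
    (hoa : Undercuts v t ρ u a b) (hoc : Undercuts v t ρ u c b) (hn : ¬ Undercuts v t ρ u a c) :
    t a + 4 * ρ a + ρ c ≤ t c := by
  have hcN := hcb.trans hb
  have haN := hac.trans hcN
  have tac := h.mono hac.le hcN
  have tcb := h.mono hcb.le hb
  have hsa := h.serv haN
  have hsc := h.serv hcN
  have hfour := h.four_mul_le hcb hb hub hoc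
  obtain ⟨o1, o2, o3⟩ := hoa
  obtain ⟨o4, o5, o6⟩ := hoc
  by_cases hcase : u a ≤ v c
  · -- the square of `c` has to avoid the tail of `a`
    by_contra hlt
    rcases le_total (t c) (t a + 4 * ρ a) with h1 | h1
    · exact h.empty hcN (x := u a) (y := t c) hcase le_rfl (by omega) (by omega)
        (h.col hac hcN (by omega) h1)
    · exact h.empty hcN (x := u a) (y := t a + 4 * ρ a) hcase h1 (by omega) (by omega)
        (h.col hac hcN (by omega) le_rfl)
  have hts : t a + ρ c ≤ t c := by
    by_contra h1
    exact hn ⟨by omega, by omega, by omega⟩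
  -- no replica between `b` and the serving node of `a` was there when `a` arrived
  have hno : ∀ x y, F a x y → v b < x → x ≤ v c → y + 5 * ρ a < t a := by
    intro x y hF h1 h2
    by_contra h3
    rcases le_total (t a) y with h4 | h4
    · have := h.left haN (h.desc haN hF h4) (by omega) le_rfl (by omega) (by omega)
      omega
    · have := h.left haN hF (by omega) h4 (by omega) (by omega)
      omega
  obtain ⟨x, y, hF, h1, h2, h3⟩ := h.exists_below hcN huc
  have hxb : v b < x := by
    by_contra hx
    exact h.empty hb (by omega) (by omega) (by omega) (by omega) (h.subset hcb.le hb hF)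
  -- consider the first request from `a` on that adds a replica between `b` and `c`
  have hex : ∃ k, a ≤ k ∧ k < c ∧ ∃ x, v b < x ∧ x ≤ v c ∧ u k ≤ x ∧ x ≤ v k := by
    rcases h.new hac.le hcN hF with h4 | rfl | ⟨k, hak, hkc, h4⟩
    · have := hno x y h4 hxb h1
      omega
    · omega
    · have := (h.serv (hkc.trans hcN)).1
      exact ⟨k, hak, hkc, x, hxb, h1, by omega, by omega⟩
  classical
  obtain ⟨hak, hkc, x', hx1, hx2, hx3, hx4⟩ := Nat.find_spec hex
  have hmin := fun m => Nat.find_min hex (m := m)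
  set k := Nat.find hex
  have hkN := hkc.trans hcN
  have hka : a < k := by
    rcases hak.eq_or_lt with h4 | h4
    · rw [← h4] at hx3; omega
    · exact h4
  have tak := h.mono hka.le hkN
  have tkc := h.mono hkc.le hcN
  have hsk := h.serv hkN
  have huk : v b < u k := by
    by_contra h4
    exact h.empty hb le_rfl (by omega) (by omega) (by omega)
      (h.row (hkc.trans hcb) hb (x := v b) (by omega) (by omega))
  have hFa : F a (u k) (s k) := by
    rcases h.new hka.le hkN hsk.2.2.2.2 with h4 | h4 | ⟨m, ham, hmk, h4⟩
    · exact h4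
    · omega
    · have := (h.serv (hmk.trans hkN)).1
      exact absurd ⟨ham, hmk.trans hkc, u k, huk, by omega, by omega, by omega⟩ (hmin m hmk)
  have hfar := hno _ _ hFa huk (by omega)
  -- the tail of `k` is longer than that of `a`, and the square of `c` has to avoid it
  by_contra hlt
  rcases le_total (t c) (t k + 4 * ρ k) with h4 | h4
  · exact h.empty hcN (x := u k) (y := t c) (by omega) le_rfl (by omega) (by omega)
      (h.col hkc hcN (by omega) h4)
  · exact h.empty hcN (x := u k) (y := t k + 4 * ρ k) (by omega) h4 (by omega) (by omega)
      (h.col hkc hcN (by omega) le_rfl)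

/-- Families of requests whose squares are pairwise disjoint. -/
def DisjointBoxes (v t ρ : ℕ → ℕ) (J : Finset ℕ) : Prop :=
  ∀ i ∈ J, ∀ j ∈ J, i < j → ∀ x y, InBox v t ρ i x y → ¬ InBox v t ρ j x y

/-- Requests whose tails lie one above the other, all within reach of the square of side `R` below
the time `T`, have a total radius of at most `R / 2`. -/
theorem two_mul_sum_le {S : Finset ℕ} {R T : ℕ}
    (hpair : ∀ a ∈ S, ∀ c ∈ S, a < c → t a + 4 * ρ a ≤ t c)
    (hS : ∀ a ∈ S, t a ≤ T ∧ T < t a + R ∧ 4 * ρ a ≤ R) : 2 * ∑ a ∈ S, ρ a ≤ R := by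
  have hdisj : (S : Set ℕ).PairwiseDisjoint fun a => Finset.Ico (t a) (t a + 4 * ρ a) := by
    intro a ha c hc hne
    refine Finset.disjoint_left.2 fun x hxa hxc => ?_
    rw [Finset.mem_Ico] at hxa hxc
    rcases lt_or_gt_of_ne hne with hlt | hlt
    · have := hpair a ha c hc hlt
      omega
    · have := hpair c hc a ha hlt
      omega
  have hsub : S.biUnion (fun a => Finset.Ico (t a) (t a + 4 * ρ a)) ⊆ Finset.Ico (T - R) (T + R) := by
    intro x hx
    obtain ⟨a, ha, hx⟩ := Finset.mem_biUnion.1 hx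
    have := hS a ha
    rw [Finset.mem_Ico] at hx ⊢
    omega
  have h1 := Finset.card_le_card hsub
  rw [Finset.card_biUnion hdisj] at h1
  simp only [Nat.card_Ico, add_tsub_cancel_left] at h1
  rw [← Finset.mul_sum] at h1
  omega

/-- The radii of Square are dominated by the radii of two families of requests with pairwise
disjoint squares: the requests served from outside their squares, and those served from
inside that are not undercut by another one of this kind. -/
theorem exists_disjointBoxes (h : IsSquareRun N v t ρ u s F) : ∃ J K : Finset ℕ,
    J ⊆ Finset.range N ∧ K ⊆ Finset.range N ∧ DisjointBoxes v t ρ J ∧ DisjointBoxes v t ρ K ∧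
    ∑ i ∈ Finset.range N, ρ i ≤ ∑ i ∈ J, ρ i + 2 * ∑ i ∈ K, ρ i := by
  classical
  set U := (Finset.range N).filter (fun i => v i < u i + ρ i) with hU
  set J := (Finset.range N).filter (fun i => ¬ v i < u i + ρ i) with hJ
  set K := U.filter (fun i => ∀ j ∈ U, i < j → ¬ Undercuts v t ρ u i j) with hK
  set M := U.filter (fun i => ¬ ∀ j ∈ U, i < j → ¬ Undercuts v t ρ u i j) with hM
  have hUN : ∀ i ∈ U, i < N ∧ v i < u i + ρ i := fun i hi => by
    simpa [hU] using hi
  refine ⟨J, K, Finset.filter_subset _ _,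
    (Finset.filter_subset _ _).trans (Finset.filter_subset _ _), ?_, ?_, ?_⟩
  · intro i hi j hj hij x y h1 h2
    have hi' := Finset.mem_filter.1 hi
    have ho := h.undercuts_of_inBox hij (Finset.mem_range.1 (Finset.mem_filter.1 hj).1) h1 h2
    have := ho.1
    have := ho.2.1
    omega
  · intro i hi j hj hij x y h1 h2
    have hj' := (Finset.mem_filter.1 hj).1
    exact (Finset.mem_filter.1 hi).2 j hj' hij
      (h.undercuts_of_inBox hij (hUN j hj').1 h1 h2)
  · -- the parent of a request is the first request that undercuts it
    have hex : ∀ i ∈ M, ∃ j, j ∈ U ∧ i < j ∧ Undercuts v t ρ u i j := by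
      intro i hi
      have := (Finset.mem_filter.1 hi).2
      push Not at this
      exact this
    let par : ℕ → ℕ := fun i => if hi : ∃ j, j ∈ U ∧ i < j ∧ Undercuts v t ρ u i j
      then Nat.find hi else 0
    have hpar : ∀ i ∈ M, (par i ∈ U ∧ i < par i ∧ Undercuts v t ρ u i (par i)) ∧
        ∀ j ∈ U, i < j → j < par i → ¬ Undercuts v t ρ u i j := by
      intro i hi
      have he := hex i hi
      simp only [par, dif_pos he]
      exact ⟨Nat.find_spec he, fun j hj hij hlt ho => Nat.find_min he hlt ⟨hj, hij, ho⟩⟩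
    have hchild : ∀ b ∈ U, 2 * ∑ a ∈ M with par a = b, ρ a ≤ ρ b := by
      intro b hb
      obtain ⟨hbN, hub⟩ := hUN b hb
      apply two_mul_sum_le (t := t) (T := t b)
      · intro a ha c hc hac
        obtain ⟨ha, hab⟩ := Finset.mem_filter.1 ha
        obtain ⟨hc, hcb⟩ := Finset.mem_filter.1 hc
        obtain ⟨⟨-, -, a3⟩, a4⟩ := hpar a ha
        obtain ⟨⟨-, c2, c3⟩, -⟩ := hpar c hc
        rw [hab] at a3 a4
        rw [hcb] at c2 c3
        have hcU := (Finset.mem_filter.1 hc).1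
        have := h.add_le_of_undercuts hac c2 hbN (hUN c hcU).2 hub a3 c3 (a4 c hcU hac c2)
        omega
      · intro a ha
        obtain ⟨ha, hab⟩ := Finset.mem_filter.1 ha
        obtain ⟨⟨-, a2, a3⟩, -⟩ := hpar a ha
        rw [hab] at a2 a3
        exact ⟨h.mono a2.le hbN, a3.2.2, h.four_mul_le a2 hbN hub a3⟩
    have hMsum : ∑ a ∈ M, ρ a = ∑ b ∈ U, ∑ a ∈ M with par a = b, ρ a :=
      (Finset.sum_fiberwise_of_maps_to (fun a ha => (hpar a ha).1.1) _).symm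
    have hM2 : 2 * ∑ a ∈ M, ρ a ≤ ∑ b ∈ U, ρ b := by
      rw [hMsum, Finset.mul_sum]
      exact Finset.sum_le_sum hchild
    have h1 : ∑ i ∈ K, ρ i + ∑ i ∈ M, ρ i = ∑ i ∈ U, ρ i :=
      Finset.sum_filter_add_sum_filter_not U _ _
    have h2 : ∑ i ∈ U, ρ i + ∑ i ∈ J, ρ i = ∑ i ∈ Finset.range N, ρ i :=
      Finset.sum_filter_add_sum_filter_not (Finset.range N) _ _
    omega

end IsSquareRun

/-! ### Lower bounds for the cost of a feasible solution -/

open MeasureTheory in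
/-- The one-dimensional Lebesgue measure on a segment. -/
noncomputable def Seg.measure : Seg → Measure (ℝ × ℝ)
  | .vert x y₁ y₂ => (volume.restrict (Set.uIcc y₁ y₂)).map (fun y => (x, y))
  | .horiz y x₁ x₂ => (volume.restrict (Set.uIcc x₁ x₂)).map (fun x => (x, y))

theorem Seg.length_nonneg (s : Seg) : 0 ≤ s.length := by
  cases s <;> exact abs_nonneg _

theorem Seg.measure_univ (s : Seg) : s.measure Set.univ = ENNReal.ofReal s.length := by
  cases s with
  | vert x y₁ y₂ =>
    rw [Seg.measure, MeasureTheory.Measure.map_apply (by fun_prop) MeasurableSet.univ]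
    simp [Seg.length]
  | horiz y x₁ x₂ =>
    rw [Seg.measure, MeasureTheory.Measure.map_apply (by fun_prop) MeasurableSet.univ]
    simp [Seg.length]

/-- The directed `L∞` distance from the point `(a, c)`; negative if one has to go left or down. -/
def quadDist (a c : ℝ) (z : ℝ × ℝ) : ℝ := min (z.1 - a) (z.2 - c)

theorem continuous_quadDist (a c : ℝ) : Continuous (quadDist a c) := by
  unfold quadDist; fun_prop

open MeasureTheory in
/-- The distance from `(a, c)` is 1-Lipschitz, so the part of a segment in `B` is at least as long
as the set of distances that occur in it. -/
theorem volume_quadDist_image_le (a c : ℝ) (s : Seg) {B : Set (ℝ × ℝ)} (hB : MeasurableSet B) :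
    volume (quadDist a c '' (s.carrier ∩ B)) ≤ s.measure B := by
  cases s with
  | vert x y₁ y₂ =>
    rw [Seg.measure, Measure.map_apply (by fun_prop) hB, Measure.restrict_apply
      (hB.preimage (by fun_prop))]
    set Y := (fun y => (x, y)) ⁻¹' B ∩ Set.uIcc y₁ y₂
    have hsub : quadDist a c '' ((Seg.vert x y₁ y₂).carrier ∩ B) ⊆
        {x - a} ∪ (fun y => y + c) ⁻¹' Y := by
      rintro _ ⟨⟨z1, z2⟩, ⟨⟨h1, h2⟩, h3⟩, rfl⟩
      simp only at h1 h2
      subst h1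
      rcases min_choice (z1 - a) (z2 - c) with h | h
      · exact Or.inl h
      · right
        change quadDist a c (z1, z2) + c ∈ Y
        rw [quadDist, h, sub_add_cancel]
        exact ⟨h3, h2⟩
    calc _ ≤ _ := measure_mono hsub
      _ ≤ volume {x - a} + volume ((fun y => y + c) ⁻¹' Y) := measure_union_le _ _
      _ = volume Y := by rw [measure_preimage_add_right]; simp
  | horiz y x₁ x₂ =>
    rw [Seg.measure, Measure.map_apply (by fun_prop) hB, Measure.restrict_apply
      (hB.preimage (by fun_prop))]
    set X := (fun x => (x, y)) ⁻¹' B ∩ Set.uIcc x₁ x₂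
    have hsub : quadDist a c '' ((Seg.horiz y x₁ x₂).carrier ∩ B) ⊆
        {y - c} ∪ (fun x => x + a) ⁻¹' X := by
      rintro _ ⟨⟨z1, z2⟩, ⟨⟨h1, h2⟩, h3⟩, rfl⟩
      simp only at h1 h2
      subst h1
      rcases min_choice (z1 - a) (z2 - c) with h | h
      · right
        change quadDist a c (z1, z2) + a ∈ X
        rw [quadDist, h, sub_add_cancel]
        exact ⟨h3, h2⟩
      · exact Or.inl h
    calc _ ≤ _ := measure_mono hsub
      _ ≤ volume {y - c} + volume ((fun x => x + a) ⁻¹' X) := measure_union_le _ _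
      _ = volume X := by rw [measure_preimage_add_right]; simp

theorem MonoStep.le {S : Finset Seg} {p q : ℝ × ℝ} (h : MonoStep S p q) : p ≤ q := by
  rcases h.1 with ⟨h1, h2⟩ | ⟨h1, h2⟩
  · exact ⟨h1.le, h2⟩
  · exact ⟨h2, h1.le⟩

/-- A monotone path from the origin to `p` passes through all distances up to that of `p`. -/
theorem exists_quadDist_eq {S : Finset Seg} {a c : ℝ} (h0 : quadDist a c (0, 0) ≤ 0) {p : ℝ × ℝ}
    (hp : Relation.ReflTransGen (MonoStep S) (0, 0) p) {d : ℝ} (hd : 0 < d)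
    (hdp : d ≤ quadDist a c p) : ∃ s ∈ S, ∃ z ∈ s.carrier, z ≤ p ∧ quadDist a c z = d := by
  induction hp with
  | refl => linarith
  | tail hab hbc ih =>
    rename_i b p
    rcases le_or_gt d (quadDist a c b) with h | h
    · obtain ⟨s, hs, z, hz, hzb, hzd⟩ := ih h
      exact ⟨s, hs, z, hz, hzb.trans hbc.le, hzd⟩
    · obtain ⟨z, hz, hzd⟩ := (convex_segment b p).isPreconnected.intermediate_value
        (left_mem_segment ℝ b p) (right_mem_segment ℝ b p)
        (continuous_quadDist a c).continuousOn ⟨h.le, hdp⟩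
      obtain ⟨s, hs, hzs⟩ := Set.mem_iUnion₂.1 (hbc.2 hz)
      exact ⟨s, hs, z, hzs, (segment_subset_Icc hbc.le hz).2, hzd⟩

/-- The total length of the segments of a solution inside a region, as a measure. -/
noncomputable def lengthIn (S : Finset Seg) : MeasureTheory.Measure (ℝ × ℝ) :=
  ∑ s ∈ S, s.measure

theorem lengthIn_univ (S : Finset Seg) : lengthIn S Set.univ = ENNReal.ofReal (cost S) := by
  rw [lengthIn, MeasureTheory.Measure.finsetSum_apply, cost,
    ENNReal.ofReal_sum_of_nonneg fun s _ => s.length_nonneg]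
  exact Finset.sum_congr rfl fun s _ => s.measure_univ

open MeasureTheory in
/-- A solution that reaches `p` has length at least the distance of `p` from `(a, c)` inside every
region that contains the quadrant between `(a, c)` and `p`. -/
theorem le_lengthIn {S : Finset Seg} {a c : ℝ} (h0 : quadDist a c (0, 0) ≤ 0) {p : ℝ × ℝ}
    (hp : Relation.ReflTransGen (MonoStep S) (0, 0) p) {B : Set (ℝ × ℝ)} (hB : MeasurableSet B)
    (hsub : ∀ z ≤ p, 0 < quadDist a c z → z ∈ B) {d : ℝ} (hd : d ≤ quadDist a c p) :
    ENNReal.ofReal d ≤ lengthIn S B := by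
  have hcov : Set.Ioc 0 d ⊆ ⋃ s ∈ S, quadDist a c '' (s.carrier ∩ B) := by
    intro e he
    obtain ⟨s, hs, z, hz, hzp, hze⟩ := exists_quadDist_eq h0 hp he.1 (he.2.trans hd)
    exact Set.mem_iUnion₂.2 ⟨s, hs, z, ⟨hz, hsub z hzp (hze ▸ he.1)⟩, hze⟩
  calc ENNReal.ofReal d = volume (Set.Ioc 0 d) := by simp
    _ ≤ volume (⋃ s ∈ S, quadDist a c '' (s.carrier ∩ B)) := measure_mono hcov
    _ ≤ ∑ s ∈ S, volume (quadDist a c '' (s.carrier ∩ B)) := measure_biUnion_finset_le _ _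
    _ ≤ ∑ s ∈ S, s.measure B := Finset.sum_le_sum fun s _ => volume_quadDist_image_le a c s hB
    _ = lengthIn S B := by rw [lengthIn, Measure.finsetSum_apply]

theorem cost_nonneg (S : Finset Seg) : 0 ≤ cost S := Finset.sum_nonneg fun s _ => s.length_nonneg

theorem quadDist_le_cost {S : Finset Seg} {a c : ℝ} (h0 : quadDist a c (0, 0) ≤ 0) {p : ℝ × ℝ}
    (hp : Relation.ReflTransGen (MonoStep S) (0, 0) p) : quadDist a c p ≤ cost S := by
  have := le_lengthIn h0 hp MeasurableSet.univ (fun _ _ _ => Set.mem_univ _) le_rfl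
  rw [lengthIn_univ] at this
  exact (ENNReal.ofReal_le_ofReal_iff (cost_nonneg S)).1 this

theorem fst_le_cost {S : Finset Seg} {p : ℝ × ℝ}
    (hp : Relation.ReflTransGen (MonoStep S) (0, 0) p) : p.1 ≤ cost S := by
  have h := quadDist_le_cost (a := 0) (c := -(|p.1| + |p.2|)) (by simp [quadDist]) hp
  have h1 := le_abs_self p.1
  have h2 := neg_abs_le p.2
  rwa [quadDist, min_eq_left (by linarith), sub_zero] at h

theorem snd_le_cost {S : Finset Seg} {p : ℝ × ℝ}
    (hp : Relation.ReflTransGen (MonoStep S) (0, 0) p) : p.2 ≤ cost S := by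
  have h := quadDist_le_cost (a := -(|p.1| + |p.2|)) (c := 0) (by simp [quadDist]) hp
  have h1 := le_abs_self p.2
  have h2 := neg_abs_le p.1
  rwa [quadDist, min_eq_right (by linarith), sub_zero] at h

/-- The part of the plane that is rounded to the grid square `IsSquareRun.InBox` of a request. -/
def realBox (q : ℕ × ℕ) (ρ : ℕ) : Set (ℝ × ℝ) :=
  {z | (q.1 : ℝ) - ρ + 1 < z.1 ∧ z.1 < q.1 + 1 ∧ (q.2 : ℝ) - ρ < z.2 ∧ z.2 ≤ q.2}

theorem measurableSet_realBox (q : ℕ × ℕ) (ρ : ℕ) : MeasurableSet (realBox q ρ) := by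
  have : realBox q ρ = Set.Ioo ((q.1 : ℝ) - ρ + 1) (q.1 + 1) ×ˢ Set.Ioc ((q.2 : ℝ) - ρ) q.2 := by
    ext z
    simp [realBox, and_assoc]
  rw [this]
  exact measurableSet_Ioo.prod measurableSet_Ioc

theorem gridPoint_mem_of_mem_realBox {q : ℕ × ℕ} {ρ : ℕ} (hρ : ρ ≤ q.1) {z : ℝ × ℝ}
    (hz : z ∈ realBox q ρ) : (gridPoint z).1 ≤ q.1 ∧ (gridPoint z).2 ≤ q.2 ∧
      q.1 < (gridPoint z).1 + ρ ∧ q.2 < (gridPoint z).2 + ρ := by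
  obtain ⟨h1, h2, h3, h4⟩ := hz
  have hρ' : (ρ : ℝ) ≤ q.1 := by exact_mod_cast hρ
  refine ⟨?_, ?_, ?_, ?_⟩
  · have : ⌊z.1⌋₊ < q.1 + 1 := (Nat.floor_lt (by linarith)).2 (by exact_mod_cast h2)
    exact Nat.lt_succ_iff.1 this
  · exact Nat.ceil_le.2 h4
  · have : q.1 - ρ + 1 ≤ ⌊z.1⌋₊ := Nat.le_floor (by push_cast [Nat.cast_sub hρ]; exact h1.le)
    change q.1 < ⌊z.1⌋₊ + ρ
    omega
  · change q.2 < ⌈z.2⌉₊ + ρ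
    by_contra hlt
    have hle : ρ ≤ q.2 := by omega
    have : q.2 - ρ < ⌈z.2⌉₊ := Nat.lt_ceil.2 (by push_cast [Nat.cast_sub hle]; exact h3)
    omega

/-- Every feasible solution pays for requests with disjoint squares; rounding to the grid costs at
most one unit per request. -/
theorem sum_rad_le_cost {S : Finset Seg} {p : ℕ → ℝ × ℝ} {ρ : ℕ → ℕ} {J : Finset ℕ}
    (hp0 : ∀ i ∈ J, 0 ≤ (p i).1 ∧ 0 ≤ (p i).2)
    (hS : ∀ i ∈ J, Relation.ReflTransGen (MonoStep S) (0, 0) (p i))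
    (hρ : ∀ i ∈ J, ρ i ≤ (gridPoint (p i)).1)
    (hJ : IsSquareRun.DisjointBoxes (fun i => (gridPoint (p i)).1) (fun i => (gridPoint (p i)).2)
      ρ J) :
    (∑ i ∈ J, ρ i : ℕ) ≤ cost S + J.card := by
  have hdisj : (J : Set ℕ).PairwiseDisjoint fun i => realBox (gridPoint (p i)) (ρ i) := by
    intro i hi j hj hne
    refine Set.disjoint_left.2 fun z hzi hzj => ?_
    rcases lt_or_gt_of_ne hne with h | h
    · exact hJ i hi j hj h _ _ (gridPoint_mem_of_mem_realBox (hρ i hi) hzi)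
        (gridPoint_mem_of_mem_realBox (hρ j hj) hzj)
    · exact hJ j hj i hi h _ _ (gridPoint_mem_of_mem_realBox (hρ j hj) hzj)
        (gridPoint_mem_of_mem_realBox (hρ i hi) hzi)
  have hle : ∀ i ∈ J, ENNReal.ofReal ((ρ i - 1 : ℕ) : ℝ) ≤
      lengthIn S (realBox (gridPoint (p i)) (ρ i)) := by
    intro i hi
    rcases Nat.eq_zero_or_pos (ρ i) with h0 | h0
    · simp [h0]
    obtain ⟨hx0, hy0⟩ := hp0 i hi
    have hρ' : (ρ i : ℝ) ≤ (gridPoint (p i)).1 := by exact_mod_cast hρ i hi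
    have hx1 : ((gridPoint (p i)).1 : ℝ) ≤ (p i).1 := Nat.floor_le hx0
    have hx2 : (p i).1 < (gridPoint (p i)).1 + 1 := Nat.lt_floor_add_one _
    have hy1 : (p i).2 ≤ (gridPoint (p i)).2 := Nat.le_ceil _
    have hy2 : ((gridPoint (p i)).2 : ℝ) < (p i).2 + 1 := Nat.ceil_lt_add_one hy0
    refine le_lengthIn (a := (gridPoint (p i)).1 - ρ i + 1) (c := (gridPoint (p i)).2 - ρ i) ?_
      (hS i hi) (measurableSet_realBox _ _) ?_ ?_
    · exact (min_le_left _ _).trans (by simp only; linarith)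
    · rintro z ⟨hz1, hz2⟩ hz
      obtain ⟨h1, h2⟩ := lt_min_iff.1 hz
      exact ⟨by linarith, by linarith, by linarith, by linarith⟩
    · rw [Nat.cast_sub h0, Nat.cast_one]
      exact le_min (by linarith) (by linarith)
  have h1 := MeasureTheory.sum_measure_le_measure_univ (μ := lengthIn S) (s := J)
    (fun i _ => (measurableSet_realBox (gridPoint (p i)) (ρ i)).nullMeasurableSet)
    (fun i hi j hj hne => (hdisj hi hj hne).aedisjoint)
  have h2 := (Finset.sum_le_sum hle).trans h1
  rw [lengthIn_univ, ← ENNReal.ofReal_sum_of_nonneg (fun i _ => Nat.cast_nonneg _),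
    ENNReal.ofReal_le_ofReal_iff (cost_nonneg S), ← Nat.cast_sum] at h2
  have h3 : ∑ i ∈ J, ρ i ≤ ∑ i ∈ J, (ρ i - 1) + J.card := by
    rw [Finset.card_eq_sum_ones, ← Finset.sum_add_distrib]
    exact Finset.sum_le_sum fun i _ => by omega
  have h4 : ((∑ i ∈ J, ρ i : ℕ) : ℝ) ≤ (∑ i ∈ J, (ρ i - 1) : ℕ) + J.card := by
    exact_mod_cast h3
  linarith

/-- The sum of the radii of Square is at most three times the optimum, up to rounding. -/
theorem sum_rad_sqRun_le {ch : Choices} {n N : ℕ} {p : ℕ → ℝ × ℝ} {S : Finset Seg}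
    (h : IsRequests n N (fun i => gridPoint (p i))) (hp0 : ∀ i < N, 0 ≤ (p i).1 ∧ 0 ≤ (p i).2)
    (hS : ∀ i < N, Relation.ReflTransGen (MonoStep S) (0, 0) (p i)) :
    (∑ i ∈ Finset.range N, (sqRun ch (fun i => gridPoint (p i)) i).rad (gridPoint (p i)) : ℕ) ≤
      3 * (cost S + N) := by
  obtain ⟨J, K, hJ, hK, dJ, dK, hle⟩ := (isSquareRun_sqRun (ch := ch) h).exists_disjointBoxes
  have hbound : ∀ I ⊆ Finset.range N, IsSquareRun.DisjointBoxes (fun i => (gridPoint (p i)).1)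
      (fun i => (gridPoint (p i)).2)
      (fun i => (sqRun ch (fun i => gridPoint (p i)) i).rad (gridPoint (p i))) I →
      (∑ i ∈ I, (sqRun ch (fun i => gridPoint (p i)) i).rad (gridPoint (p i)) : ℕ) ≤
        cost S + N := by
    intro I hI dI
    have h1 := sum_rad_le_cost (S := S) (fun i hi => hp0 i (Finset.mem_range.1 (hI hi)))
      (fun i hi => hS i (Finset.mem_range.1 (hI hi)))
      (fun i hi => (sqRun_valid h (Finset.mem_range.1 (hI hi)).le).rad_le_fst _) dI
    have h2 : (I.card : ℝ) ≤ N := by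
      have := Finset.card_le_card hI
      rw [Finset.card_range] at this
      exact_mod_cast this
    linarith
  have h1 := hbound J hJ dJ
  have h2 := hbound K hK dK
  have h3 := (Nat.cast_le (α := ℝ)).2 hle
  push_cast at h1 h2 h3 ⊢
  linarith

/-! ### The online grid algorithm: invariants -/

theorem mem_nbhd {δ l v u : ℕ} :
    u ∈ nbhd δ l v ↔ u ≤ v ∧ (u / δ ^ l = v / δ ^ l ∨ u / δ ^ l + 1 = v / δ ^ l) := by
  simp [nbhd]

theorem self_mem_nbhd (δ l v : ℕ) : v ∈ nbhd δ l v := mem_nbhd.2 ⟨le_rfl, Or.inl rfl⟩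

theorem nbhd_subset {δ l v w : ℕ} (hvw : v ≤ w) (h : v / δ ^ l = w / δ ^ l) :
    nbhd δ l v ⊆ nbhd δ l w := by
  intro u hu
  rw [mem_nbhd] at hu ⊢
  rw [← h]
  exact ⟨hu.1.trans hvw, hu.2⟩

theorem lt_add_of_mem_nbhd {δ l v u : ℕ} (hδ : 0 < δ) (hu : u ∈ nbhd δ l v) :
    v < u + 2 * δ ^ l := by
  have hD : 0 < δ ^ l := pow_pos hδ l
  have h1 := Nat.div_add_mod v (δ ^ l)
  have h2 := Nat.div_add_mod u (δ ^ l)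
  have h3 := Nat.mod_lt v hD
  have h4 := Nat.zero_le (u % δ ^ l)
  rcases (mem_nbhd.1 hu).2 with h | h
  · rw [h] at h2
    omega
  · rw [← h, mul_add] at h1
    omega

/-- The invariants of the online grid algorithm. The field `stay` is what makes the storage rule
executable: a node that was stay-active one time unit ago has a stored copy nearby. -/
structure OnState.Valid (δ n : ℕ) (d : OnState) : Prop where
  sq : d.sq.Valid n
  time : d.sq.time ≤ d.time
  zero : 0 ∈ d.cache
  sub : d.cache ⊆ d.avail
  base_avail : ∀ u, (u, d.time) ∈ d.sq.base → u ∈ d.avail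
  tail_cache : ∀ u, (u, d.time) ∈ d.sq.tail → u ∈ d.cache ∨ (u, d.time) ∈ d.sq.base
  stay : ∀ l ≤ Nat.clog δ n, ∀ v ≤ n, ∀ s < d.time, (v, s) ∈ d.sq.base ∪ d.sq.tail →
    d.time ≤ s + δ ^ l → ∃ u ∈ nbhd δ l v, u ∈ d.cache

theorem OnState.valid_init (δ n : ℕ) : OnState.init.Valid δ n := by
  constructor
  · exact SqState.valid_init n
  all_goals simp [OnState.init, SqState.init]

section
variable {δ n l v : ℕ} {d : OnState} {ch : Choices} {C : Finset ℕ}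

/-- The storage rule always finds a copy to store. -/
theorem OnState.Valid.options_nonempty (h : d.Valid δ n) (hl : l ≤ Nat.clog δ n) (hv : v ≤ n)
    (hs : StayActive d.sq δ l v d.time) :
    ((nbhd δ l v).filter (fun u => (u, d.time) ∈ d.sq.base ∨ u ∈ d.cache)).Nonempty := by
  obtain ⟨s, hm, h1, h2⟩ := hs
  rcases h1.lt_or_eq with h1 | rfl
  · obtain ⟨u, hu, huc⟩ := h.stay l hl v hv s h1 hm h2.le
    exact ⟨u, Finset.mem_filter.2 ⟨hu, Or.inr huc⟩⟩
  · refine ⟨v, Finset.mem_filter.2 ⟨self_mem_nbhd δ l v, ?_⟩⟩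
    rcases Finset.mem_union.1 hm with hm | hm
    · exact Or.inl hm
    · exact (h.tail_cache v hm).symm

theorem OnState.subset_select : C ⊆ d.select ch δ l C v := by
  unfold OnState.select
  split_ifs
  · exact Finset.subset_insert _ _
  · exact subset_rfl

theorem OnState.Valid.select_subset (h : d.Valid δ n) (hl : l ≤ Nat.clog δ n) (hv : v ≤ n)
    (hC : C ⊆ d.avail) : d.select ch δ l C v ⊆ d.avail := by
  classical
  unfold OnState.select
  split_ifs with hc
  · refine Finset.insert_subset ?_ hC
    have := (Finset.mem_filter.1 (ch.store_mem d.time l v _ (h.options_nonempty hl hv hc.1))).2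
    rcases this with h1 | h1
    · exact h.base_avail _ h1
    · exact h.sub h1
  · exact hC

theorem OnState.Valid.select_hits (h : d.Valid δ n) (hl : l ≤ Nat.clog δ n) (hv : v ≤ n)
    (hs : StayActive d.sq δ l v d.time) : ¬ Disjoint (d.select ch δ l C v) (nbhd δ l v) := by
  classical
  unfold OnState.select
  split_ifs with hc
  · have := (Finset.mem_filter.1 (ch.store_mem d.time l v _ (h.options_nonempty hl hv hc.1))).1
    exact fun hd => Finset.disjoint_left.1 hd (Finset.mem_insert_self _ _) this
  · exact fun hd => hc ⟨hs, hd⟩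

/-- The treatment of the nodes `0, …, k - 1` at level `l`. -/
noncomputable def OnState.selectUpTo (ch : Choices) (δ : ℕ) (d : OnState) (l : ℕ) (C : Finset ℕ)
    (k : ℕ) : Finset ℕ :=
  (List.range k).foldl (d.select ch δ l) C

theorem OnState.selectUpTo_succ (k : ℕ) :
    d.selectUpTo ch δ l C (k + 1) = d.select ch δ l (d.selectUpTo ch δ l C k) k := by
  simp [OnState.selectUpTo, List.range_succ]

theorem OnState.selectUpTo_mono {k m : ℕ} (hkm : k ≤ m) :
    d.selectUpTo ch δ l C k ⊆ d.selectUpTo ch δ l C m := by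
  induction m, hkm using Nat.le_induction with
  | base => exact subset_rfl
  | succ m _ ih =>
    rw [OnState.selectUpTo_succ]
    exact ih.trans OnState.subset_select

theorem OnState.Valid.selectUpTo_subset (h : d.Valid δ n) (hl : l ≤ Nat.clog δ n)
    (hC : C ⊆ d.avail) {k : ℕ} (hk : k ≤ n + 1) : d.selectUpTo ch δ l C k ⊆ d.avail := by
  induction k with
  | zero => simpa [OnState.selectUpTo] using hC
  | succ k ih =>
    rw [OnState.selectUpTo_succ]
    exact h.select_subset hl (by omega) (ih (by omega))

theorem OnState.Valid.selectUpTo_hits (h : d.Valid δ n) (hl : l ≤ Nat.clog δ n) {k : ℕ}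
    (hk : k ≤ n + 1) (hv : v < k) (hs : StayActive d.sq δ l v d.time) :
    ¬ Disjoint (d.selectUpTo ch δ l C k) (nbhd δ l v) := by
  have h1 := h.select_hits (ch := ch) (C := d.selectUpTo ch δ l C v) hl (v := v) (by omega) hs
  rw [← OnState.selectUpTo_succ] at h1
  exact fun hd => h1 (hd.mono_left (OnState.selectUpTo_mono hv))

open Classical in
/-- The level-`l` intervals that contain a stay-active node below `k`. -/
noncomputable def activeIntervals (σ : SqState) (δ l t k : ℕ) : Finset ℕ :=
  ((Finset.range k).filter (fun v => StayActive σ δ l v t)).image (fun v => v / δ ^ l)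

theorem mem_activeIntervals {σ : SqState} {t k j : ℕ} :
    j ∈ activeIntervals σ δ l t k ↔ ∃ v < k, StayActive σ δ l v t ∧ v / δ ^ l = j := by
  simp [activeIntervals, and_assoc]

/-- At every level at most one node is stored for each interval with a stay-active node: a node
stored for `v` lies in the neighbourhood of all later nodes of the interval. -/
theorem OnState.Valid.card_selectUpTo_le (h : d.Valid δ n) (hl : l ≤ Nat.clog δ n) {k : ℕ}
    (hk : k ≤ n + 1) :
    (d.selectUpTo ch δ l C k).card ≤ C.card + (activeIntervals d.sq δ l d.time k).card := by
  classical
  induction k with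
  | zero => simp [OnState.selectUpTo]
  | succ k ih =>
    have ih := ih (by omega)
    have hsub : activeIntervals d.sq δ l d.time k ⊆ activeIntervals d.sq δ l d.time (k + 1) := by
      intro j hj
      obtain ⟨v, hv, hv'⟩ := mem_activeIntervals.1 hj
      exact mem_activeIntervals.2 ⟨v, by omega, hv'⟩
    rw [OnState.selectUpTo_succ, OnState.select]
    split_ifs with hc
    · have hnew : k / δ ^ l ∉ activeIntervals d.sq δ l d.time k := by
        intro hj
        obtain ⟨v, hv, hva, hvk⟩ := mem_activeIntervals.1 hj
        exact h.selectUpTo_hits (ch := ch) (C := C) hl (by omega) hv hva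
          (hc.2.mono_right (nbhd_subset hv.le hvk))
      have h1 : (activeIntervals d.sq δ l d.time k).card <
          (activeIntervals d.sq δ l d.time (k + 1)).card :=
        Finset.card_lt_card ⟨hsub, fun hh => hnew (hh (mem_activeIntervals.2
          ⟨k, by omega, hc.1, rfl⟩))⟩
      have h2 := Finset.card_insert_le (ch.store d.time l k ((nbhd δ l k).filter
        (fun u => (u, d.time) ∈ d.sq.base ∨ u ∈ d.cache))) (d.selectUpTo ch δ l C k)
      omega
    · have := Finset.card_le_card hsub
      omega

/-- The nodes that are stored in any case: the origin and the nodes of the current tails. -/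
noncomputable def OnState.forced (d : OnState) : Finset ℕ :=
  {0} ∪ (d.sq.tail.filter (fun q => q.2 = d.time)).image Prod.fst

/-- The nodes selected for storage after the treatment of the levels below `L`. -/
noncomputable def OnState.storedUpTo (ch : Choices) (δ n : ℕ) (d : OnState) (L : ℕ) : Finset ℕ :=
  (List.range L).foldl (fun C l => d.selectUpTo ch δ l C (n + 1)) d.forced

theorem OnState.stored_eq :
    d.stored ch δ n = d.storedUpTo ch δ n (Nat.clog δ n + 1) := rfl

theorem OnState.storedUpTo_succ (L : ℕ) : d.storedUpTo ch δ n (L + 1) =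
    d.selectUpTo ch δ L (d.storedUpTo ch δ n L) (n + 1) := by
  simp [OnState.storedUpTo, List.range_succ]

theorem OnState.storedUpTo_mono {k m : ℕ} (hkm : k ≤ m) :
    d.storedUpTo ch δ n k ⊆ d.storedUpTo ch δ n m := by
  induction m, hkm using Nat.le_induction with
  | base => exact subset_rfl
  | succ m _ ih =>
    rw [OnState.storedUpTo_succ]
    exact ih.trans (OnState.selectUpTo_mono (Nat.zero_le _))

theorem OnState.forced_subset_stored : d.forced ⊆ d.stored ch δ n :=
  OnState.storedUpTo_mono (Nat.zero_le _)

theorem OnState.mem_forced_of_tail {u : ℕ} (hu : (u, d.time) ∈ d.sq.tail) : u ∈ d.forced :=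
  Finset.mem_union_right _ (Finset.mem_image.2 ⟨_, Finset.mem_filter.2 ⟨hu, rfl⟩, rfl⟩)

theorem OnState.Valid.stored_subset (h : d.Valid δ n) : d.stored ch δ n ⊆ d.avail := by
  have hforced : d.forced ⊆ d.avail := by
    intro u hu
    rcases Finset.mem_union.1 hu with hu | hu
    · rw [Finset.mem_singleton.1 hu]
      exact h.sub h.zero
    · obtain ⟨⟨x, y⟩, hq, rfl⟩ := Finset.mem_image.1 hu
      obtain ⟨hq, hy⟩ := Finset.mem_filter.1 hq
      simp only at hy
      rw [hy] at hq
      rcases h.tail_cache _ hq with h1 | h1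
      · exact h.sub h1
      · exact h.base_avail _ h1
  have : ∀ L ≤ Nat.clog δ n + 1, d.storedUpTo ch δ n L ⊆ d.avail := by
    intro L hL
    induction L with
    | zero => exact hforced
    | succ L ih =>
      rw [OnState.storedUpTo_succ]
      exact h.selectUpTo_subset (by omega) (ih (by omega)) le_rfl
  exact this _ le_rfl

theorem OnState.Valid.stored_hits (h : d.Valid δ n) (hl : l ≤ Nat.clog δ n) (hv : v ≤ n)
    (hs : StayActive d.sq δ l v d.time) : ∃ u ∈ nbhd δ l v, u ∈ d.stored ch δ n := by
  have h1 := h.selectUpTo_hits (ch := ch) (C := d.storedUpTo ch δ n l) hl le_rfl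
    (Nat.lt_succ_of_le hv) hs
  rw [← OnState.storedUpTo_succ] at h1
  obtain ⟨u, hu, hu'⟩ := Finset.not_disjoint_iff.1 h1
  exact ⟨u, hu', OnState.storedUpTo_mono (Nat.succ_le_succ hl) hu⟩

theorem OnState.Valid.card_stored_le (h : d.Valid δ n) : (d.stored ch δ n).card ≤
    1 + (d.sq.tail.filter (fun q => q.2 = d.time)).card +
      ∑ l ∈ Finset.range (Nat.clog δ n + 1), (activeIntervals d.sq δ l d.time (n + 1)).card := by
  have hforced : d.forced.card ≤ 1 + (d.sq.tail.filter (fun q => q.2 = d.time)).card :=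
    (Finset.card_union_le _ _).trans (by
      rw [Finset.card_singleton]
      exact Nat.add_le_add_left Finset.card_image_le 1)
  have : ∀ L ≤ Nat.clog δ n + 1, (d.storedUpTo ch δ n L).card ≤ d.forced.card +
      ∑ l ∈ Finset.range L, (activeIntervals d.sq δ l d.time (n + 1)).card := by
    intro L hL
    induction L with
    | zero => simp [OnState.storedUpTo]
    | succ L ih =>
      have h1 := h.card_selectUpTo_le (ch := ch) (C := d.storedUpTo ch δ n L) (l := L)
        (by omega) le_rfl
      rw [OnState.storedUpTo_succ, Finset.sum_range_succ]
      have := ih (by omega)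
      omega
  have := this _ le_rfl
  rw [← OnState.stored_eq] at this
  omega

theorem OnState.Valid.tick (h : d.Valid δ n) (ch : Choices) : (d.tick ch δ n).Valid δ n := by
  constructor
  · exact h.sq
  · exact h.time.trans (Nat.le_succ _)
  · exact OnState.forced_subset_stored (Finset.mem_union_left _ (Finset.mem_singleton_self 0))
  · exact subset_rfl
  · intro u hu
    have h1 := (h.sq.base_le _ _ hu).1
    have h2 := h.time
    change d.time + 1 ≤ _ at h1
    omega
  · intro u hu
    left
    obtain ⟨s, h1, h2, h3⟩ := h.sq.tail_start _ _ hu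
    have h4 := (h.sq.base_le _ _ h2).1
    exact OnState.forced_subset_stored
      (OnState.mem_forced_of_tail (h3 d.time (h4.trans h.time) (Nat.le_succ _)))
  · intro l hl v hv s hs hm hle
    exact h.stored_hits hl hv ⟨s, hm, Nat.lt_succ_iff.1 hs, hle⟩

variable {r : ℕ × ℕ}

theorem OnState.Valid.source_mem (h : d.Valid δ n) (r : ℕ × ℕ) :
    d.source r ∈ d.avail ∧ d.source r ≤ d.sq.servNode r := by
  have hne : (d.avail.filter (fun u => u ≤ d.sq.servNode r)).Nonempty :=
    ⟨0, Finset.mem_filter.2 ⟨h.sub h.zero, Nat.zero_le _⟩⟩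
  obtain ⟨w, hw, he⟩ := Finset.exists_mem_eq_sup _ hne id
  have : d.source r = w := he
  rw [this]
  exact Finset.mem_filter.1 hw

theorem OnState.le_source {w : ℕ} (hw : w ∈ d.avail) (hle : w ≤ d.sq.servNode r) :
    w ≤ d.source r :=
  Finset.le_sup (f := id) (Finset.mem_filter.2 ⟨hw, hle⟩)

theorem OnState.Valid.deliver (h : d.Valid δ n) (ch : Choices) (hr : r.2 = d.time)
    (hn : r.1 ≤ n) : (d.deliver ch r).Valid δ n := by
  have hsrc := (h.source_mem r).2
  have hsv := (h.sq.serv_bounds ch r).1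
  constructor
  · exact h.sq.handle ch (hr ▸ h.time) hn
  · exact hr.le
  · exact h.zero
  · exact h.sub.trans Finset.subset_union_left
  · intro u hu
    rcases SqState.mem_handle_base.1 hu with h1 | h1
    · exact Finset.mem_union_left _ (h.base_avail u h1)
    · exact Finset.mem_union_right _ (Finset.mem_Icc.2 ⟨hsrc.trans h1.1, h1.2.1⟩)
  · intro u hu
    rcases SqState.mem_handle_tail.1 hu with h1 | ⟨rfl, h1⟩
    · rcases h.tail_cache u h1 with h2 | h2
      · exact Or.inl h2
      · exact Or.inr (SqState.mem_handle_base.2 (Or.inl h2))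
    · exact Or.inr (SqState.mem_handle_base.2 (Or.inr ⟨le_rfl, hsv, hr.symm⟩))
  · intro l hl v hv s hs hm hle
    change s < d.time at hs
    refine h.stay l hl v hv s hs ?_ hle
    rw [Finset.mem_union] at hm ⊢
    rcases hm with hm | hm
    · rcases SqState.mem_handle_base.1 hm with h1 | h1
      · exact Or.inl h1
      · omega
    · rcases SqState.mem_handle_tail.1 hm with h1 | h1
      · exact Or.inr h1
      · omega

/-- The source of a delivery is close to the serving node of Square: since that node was touched at
most `5ρ` ago, it is still stay-active at the first level `l` with `5ρ < δ ^ l`. -/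
theorem OnState.Valid.servNode_le (h : d.Valid δ n) (hδ : 2 ≤ δ) (hr : r.2 = d.time)
    (hn : r.1 ≤ n) : d.sq.servNode r ≤ d.source r + 10 * δ * d.sq.rad r := by
  set u := d.sq.servNode r with hu
  set ρ := d.sq.rad r with hρ
  obtain ⟨s, hs⟩ := h.sq.servNode_mem r
  obtain ⟨hs1, hs2⟩ := Finset.mem_inter.1 hs
  obtain ⟨b1, -, b3, b4⟩ := mem_rect.1 hs1
  have hex : u = 0 ∨ ∃ s, (u, s) ∈ d.sq.base ∪ d.sq.tail ∧ s ≤ r.2 ∧ r.2 ≤ s + 5 * ρ := by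
    rcases SqState.mem_extended.1 hs2 with h1 | h1
    · rcases h.sq.late _ _ h1 with h2 | h2 | ⟨s', h2, h3, h4⟩
      · exact Or.inl h2
      · exact Or.inr ⟨s, h2, b3, b4⟩
      · have := h.time
        exact Or.inr ⟨s', Finset.mem_union_left _ h4, by omega, by omega⟩
    · exact Or.inl h1.1
  rcases hex with h0 | ⟨s, hm, h1, h2⟩
  · omega
  rcases h1.eq_or_lt with h1 | h1
  · have hav : u ∈ d.avail := by
      rw [h1, hr] at hm
      rcases Finset.mem_union.1 hm with hm | hm
      · exact h.base_avail u hm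
      · rcases h.tail_cache u hm with h3 | h3
        · exact h.sub h3
        · exact h.base_avail u h3
    have := OnState.le_source (r := r) hav le_rfl
    omega
  · have hρ0 : 0 < ρ := by omega
    have hlarge : 5 * ρ ≤ 10 * δ * ρ := by nlinarith
    by_cases hbig : n ≤ 5 * ρ
    · omega
    obtain ⟨l, hl, hl1, hl2⟩ : ∃ l ≤ Nat.clog δ n, 5 * ρ < δ ^ l ∧ δ ^ l ≤ 5 * ρ * δ := by
      have hlt : ∃ l, 5 * ρ < δ ^ l := ⟨Nat.clog δ n, by
        have := Nat.le_pow_clog (b := δ) (by omega) n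
        omega⟩
      classical
      refine ⟨Nat.find hlt, Nat.find_min' hlt ?_, Nat.find_spec hlt, ?_⟩
      · have := Nat.le_pow_clog (b := δ) (by omega) n
        omega
      · rcases hf : Nat.find hlt with _ | l
        · have := Nat.find_spec hlt
          rw [hf, pow_zero] at this
          omega
        · have := Nat.find_min hlt (m := l) (by omega)
          rw [pow_succ]
          exact Nat.mul_le_mul_right δ (not_lt.1 this)
    obtain ⟨w, hw, hwc⟩ := h.stay l hl u (b1.trans hn) s (by omega) hm (by omega)
    have h3 := OnState.le_source (r := r) (h.sub hwc) (mem_nbhd.1 hw).1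
    have h4 := lt_add_of_mem_nbhd (by omega) hw
    have h5 : 10 * δ * ρ = 2 * (5 * ρ * δ) := by ring
    omega

end

/-! ### Counting the stored copies -/

/-- The replicas of the solution form an arborescence, so a replica has ancestors at all distances
up to its own distance from the origin. -/
theorem SqState.Valid.exists_dist {n : ℕ} {σ : SqState} (h : σ.Valid n) {x y k : ℕ} (hk : k ≤ x)
    {a b : ℕ} (hm : (a, b) ∈ σ.soln) (ha : a ≤ x) (hb : b ≤ y) (hd : max (x - a) (y - b) ≤ k) :
    ∃ a b, (a, b) ∈ σ.soln ∧ a ≤ x ∧ b ≤ y ∧ max (x - a) (y - b) = k := by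
  induction hs : a + b using Nat.strong_induction_on generalizing a b with
  | _ m ih =>
    rcases hd.eq_or_lt with hd | hd
    · exact ⟨a, b, hm, ha, hb, hd⟩
    · have hd1 := lt_of_le_of_lt (le_max_left _ _) hd
      have hd2 := lt_of_le_of_lt (le_max_right _ _) hd
      rcases h.pred a b hm with hh | ⟨a', e, hh⟩ | ⟨b', e, hh⟩
      · omega
      · exact ih (a' + b) (by omega) hh (by omega) hb (max_le (by omega) (by omega)) rfl
      · exact ih (a + b') (by omega) hh ha (by omega) (max_le (by omega) (by omega)) rfl

/-- A replica of a node `x ≥ D` has at least `D` ancestors within distance `D`. -/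
theorem SqState.Valid.le_card_filter {n : ℕ} {σ : SqState} (h : σ.Valid n) {x y D : ℕ} (hD : D ≤ x)
    (hm : (x, y) ∈ σ.soln) :
    D ≤ (σ.soln.filter (fun q => q.1 ≤ x ∧ q.2 ≤ y ∧ x < q.1 + D ∧ y < q.2 + D)).card := by
  have hsub : Finset.range D ⊆
      (σ.soln.filter (fun q => q.1 ≤ x ∧ q.2 ≤ y ∧ x < q.1 + D ∧ y < q.2 + D)).image
        (fun q => max (x - q.1) (y - q.2)) := by
    intro k hk
    rw [Finset.mem_range] at hk
    obtain ⟨a, b, hab, ha, hb, hd⟩ := h.exists_dist (k := k) (by omega) hm le_rfl le_rfl (by simp)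
    have := le_max_left (x - a) (y - b)
    have := le_max_right (x - a) (y - b)
    exact Finset.mem_image.2 ⟨(a, b), Finset.mem_filter.2 ⟨hab, ha, hb, by dsimp only; omega,
      by dsimp only; omega⟩, hd⟩
  have h1 := Finset.card_le_card hsub
  rw [Finset.card_range] at h1
  exact h1.trans Finset.card_image_le

/-- Two consecutive blocks of length `D` contain all numbers less than `D` below `x`. -/
theorem div_eq_or_of_lt_add {a x D : ℕ} (h1 : a ≤ x) (h2 : x < a + D) :
    x / D = a / D ∨ x / D = a / D + 1 := by
  have hD : 0 < D := by omega
  have h3 : a / D ≤ x / D := Nat.div_le_div_right h1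
  have h4 : x / D ≤ (a + D) / D := Nat.div_le_div_right h2.le
  rw [Nat.add_div_right _ hD] at h4
  omega

/-- The `D × D` blocks of the grid, off the first column of blocks, that contain a base or tail
replica are paid for by the solution: the `D` ancestors of the replica within distance `D` lie in
four blocks. -/
theorem SqState.Valid.mul_card_blocks_le {n : ℕ} {σ : SqState} (h : σ.Valid n) {D : ℕ}
    (hD : 0 < D) :
    D * (((σ.base ∪ σ.tail).image (fun q => (q.1 / D, q.2 / D))).filter (fun b => 1 ≤ b.1)).card ≤
      4 * σ.soln.card := by
  set B := ((σ.base ∪ σ.tail).image (fun q => (q.1 / D, q.2 / D))).filter (fun b => 1 ≤ b.1)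
  let near : ℕ × ℕ → Finset (ℕ × ℕ) := fun q => {q.1 / D, q.1 / D + 1} ×ˢ {q.2 / D, q.2 / D + 1}
  have h1 : ∀ b ∈ B, D ≤ (σ.soln.filter (fun q => b ∈ near q)).card := by
    intro b hb
    obtain ⟨hb, hb1⟩ := Finset.mem_filter.1 hb
    obtain ⟨⟨x, y⟩, hxy, rfl⟩ := Finset.mem_image.1 hb
    have hx : D ≤ x := (Nat.one_le_div_iff hD).1 hb1
    refine (h.le_card_filter hx (h.sub hxy)).trans (Finset.card_le_card ?_)
    rintro ⟨a, b⟩ hq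
    obtain ⟨hq, a1, a2, a3, a4⟩ := Finset.mem_filter.1 hq
    refine Finset.mem_filter.2 ⟨hq, ?_⟩
    simp only [near, Finset.mem_product, Finset.mem_insert, Finset.mem_singleton]
    exact ⟨div_eq_or_of_lt_add a1 a3, div_eq_or_of_lt_add a2 a4⟩
  calc D * B.card = ∑ b ∈ B, D := by rw [Finset.sum_const, smul_eq_mul, mul_comm]
    _ ≤ ∑ b ∈ B, (σ.soln.filter (fun q => b ∈ near q)).card := Finset.sum_le_sum h1
    _ = ∑ q ∈ σ.soln, (B.filter (fun b => b ∈ near q)).card :=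
        Finset.sum_card_bipartiteAbove_eq_sum_card_bipartiteBelow (fun b q => b ∈ near q)
    _ ≤ ∑ q ∈ σ.soln, 4 := by
        refine Finset.sum_le_sum fun q _ => ?_
        refine (Finset.card_le_card (t := near q) fun b hb => (Finset.mem_filter.1 hb).2).trans ?_
        rw [Finset.card_product]
        exact Nat.mul_le_mul Finset.card_le_two Finset.card_le_two
    _ = 4 * σ.soln.card := by rw [Finset.sum_const, smul_eq_mul, mul_comm]

/-- At every level the number of the stored copies is at most proportional to the size of the
solution of Square. -/
theorem SqState.Valid.sum_card_activeIntervals_le {n : ℕ} {σ : SqState} (h : σ.Valid n) {δ : ℕ}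
    (hδ : 0 < δ) (l k T : ℕ) :
    ∑ t ∈ Finset.range T, (activeIntervals σ δ l t k).card ≤ T + 8 * σ.soln.card := by
  classical
  set D := δ ^ l
  have hD : 0 < D := pow_pos hδ l
  set B := ((σ.base ∪ σ.tail).image (fun q => (q.1 / D, q.2 / D))).filter (fun b => 1 ≤ b.1)
  set A := (Finset.range T).sigma fun t => activeIntervals σ δ l t k
  have hA : A.card = ∑ t ∈ Finset.range T, (activeIntervals σ δ l t k).card :=
    Finset.card_sigma _ _
  -- an interval is only active in a block of time with a base or tail replica, or in the next one
  have hsub : A ⊆ (Finset.range T).sigma (fun _ => {0}) ∪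
      (B ×ˢ Finset.range (2 * D)).image (fun c => ⟨D * c.1.2 + c.2, c.1.1⟩) := by
    rintro ⟨t, j⟩ htj
    obtain ⟨ht, hj⟩ := Finset.mem_sigma.1 htj
    obtain ⟨v, -, ⟨s, hs, hst, hts⟩, rfl⟩ := mem_activeIntervals.1 hj
    simp only at hst hts ht
    rw [Finset.mem_union]
    by_cases h0 : v / D = 0
    · exact Or.inl (Finset.mem_sigma.2 ⟨ht, Finset.mem_singleton.2 h0⟩)
    · right
      have h1 := Nat.div_add_mod s D
      have h2 := Nat.mod_lt s hD
      refine Finset.mem_image.2 ⟨((v / D, s / D), t - D * (s / D)), Finset.mem_product.2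
        ⟨Finset.mem_filter.2 ⟨Finset.mem_image_of_mem _ hs, Nat.one_le_iff_ne_zero.2 h0⟩, ?_⟩, ?_⟩
      · rw [Finset.mem_range]
        change t < s + D at hts
        dsimp only
        omega
      · dsimp only
        rw [Nat.add_sub_cancel' (by omega)]
  have h1 := (Finset.card_le_card hsub).trans (Finset.card_union_le _ _)
  have h2 := Finset.card_image_le (s := B ×ˢ Finset.range (2 * D))
    (f := fun c => (⟨D * c.1.2 + c.2, c.1.1⟩ : (_ : ℕ) × ℕ))
  have h3 : ((Finset.range T).sigma (fun _ => ({0} : Finset ℕ))).card = T := by simp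
  have h4 := h.mul_card_blocks_le hD
  rw [Finset.card_product, Finset.card_range] at h2
  have h5 : B.card * (2 * D) = 2 * (D * B.card) := by ring
  rw [h3] at h1
  rw [← hA]
  change D * B.card ≤ _ at h4
  omega

/-! ### The rules of the online model -/

/-- The sequence of the states of the grid-rounding algorithm. -/
noncomputable abbrev gridRun (ch : Choices) (n : ℕ) (p : ℕ → ℝ × ℝ) : ℕ → GridState :=
  seqRun (GridState.handle ch n) GridState.init p

section
variable {ch : Choices} {n : ℕ} {g : GridState}

theorem GridState.time_tick_iterate (k : ℕ) :
    ((GridState.tick ch n)^[k] g).on.time = g.on.time + k := by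
  induction k with
  | zero => rfl
  | succ k ih =>
    rw [Function.iterate_succ_apply']
    change ((GridState.tick ch n)^[k] g).on.time + 1 = _
    rw [ih, add_assoc]

theorem GridState.sq_tick_iterate (k : ℕ) :
    ((GridState.tick ch n)^[k] g).on.sq = g.on.sq := by
  induction k with
  | zero => rfl
  | succ k ih =>
    rw [Function.iterate_succ_apply']
    exact ih

theorem GridState.segs_subset_tick_iterate (k : ℕ) :
    g.segs ⊆ ((GridState.tick ch n)^[k] g).segs := by
  induction k with
  | zero => exact subset_rfl
  | succ k ih =>
    rw [Function.iterate_succ_apply']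
    exact ih.trans Finset.subset_union_left

theorem GridState.mem_segs_tick_iterate {k : ℕ} {s : Seg}
    (hs : s ∈ ((GridState.tick ch n)^[k] g).segs) :
    s ∈ g.segs ∨ ∃ v t : ℕ, g.on.time ≤ t ∧ s = Seg.vert v t (t + 1) := by
  induction k with
  | zero => exact Or.inl hs
  | succ k ih =>
    rw [Function.iterate_succ_apply'] at hs
    rcases Finset.mem_union.1 hs with hs | hs
    · exact ih hs
    · obtain ⟨v, -, rfl⟩ := Finset.mem_image.1 hs
      refine Or.inr ⟨v, _, ?_, rfl⟩
      rw [GridState.time_tick_iterate]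
      exact Nat.le_add_right _ _

theorem GridState.segs_subset_draw (g : GridState) (p : ℝ × ℝ) : g.segs ⊆ (g.draw ch p).segs :=
  Finset.subset_union_left.trans Finset.subset_union_left

theorem GridState.segs_subset_handle (g : GridState) (p : ℝ × ℝ) :
    g.segs ⊆ (g.handle ch n p).segs :=
  (GridState.segs_subset_tick_iterate _).trans (GridState.segs_subset_draw _ _)

theorem GridState.time_handle (g : GridState) (p : ℝ × ℝ) :
    (g.handle ch n p).on.time = max g.on.time (gridPoint p).2 := by
  change ((GridState.tick ch n)^[(gridPoint p).2 - g.on.time] g).on.time = _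
  rw [GridState.time_tick_iterate]
  omega

theorem snd_le_time_foldl {Q : List (ℝ × ℝ)} {q : ℝ × ℝ} (hq : q ∈ Q) :
    q.2 ≤ (Q.foldl (GridState.handle ch n) GridState.init).on.time := by
  induction Q using List.reverseRecOn with
  | nil => simp at hq
  | append_singleton Q p ih =>
    rw [List.foldl_append, List.foldl_cons, List.foldl_nil, GridState.time_handle, Nat.cast_max]
    rcases List.mem_append.1 hq with hq | hq
    · exact (ih hq).trans (le_max_left _ _)
    · rw [List.mem_singleton.1 hq]
      exact (Nat.le_ceil p.2).trans (le_max_right _ _)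

theorem isOnline_gridAlg (ch : Choices) (n : ℕ) : IsOnline (gridAlg ch n) := by
  intro Q p hQ
  have hA : gridAlg ch n (Q ++ [p]) =
      ((Q.foldl (GridState.handle ch n) GridState.init).handle ch n p).segs := by
    rw [gridAlg, List.foldl_append, List.foldl_cons, List.foldl_nil]
  have hp0 : 0 ≤ p.2 := (hQ.1 p (by simp)).2
  have hp : ∀ q ∈ Q, q.2 ≤ p.2 := fun q hq =>
    (List.pairwise_append.1 hQ.2).2.2 q hq p (List.mem_singleton_self p)
  rw [hA]
  refine ⟨GridState.segs_subset_handle _ p, ?_⟩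
  intro s hs hsQ z hz
  -- it suffices that the new segment lies above the current time or above the new point
  suffices h : ((Q.foldl (GridState.handle ch n) GridState.init).on.time : ℝ) ≤ z.2 ∨ p.2 ≤ z.2 by
    rcases h with h | h
    · exact ⟨(Nat.cast_nonneg _).trans h, fun q hq => (snd_le_time_foldl hq).trans h⟩
    · exact ⟨hp0.trans h, fun q hq => (hp q hq).trans h⟩
  rcases Finset.mem_union.1 hs with hs | hs
  · rcases Finset.mem_union.1 hs with hs | hs
    · rcases GridState.mem_segs_tick_iterate hs with hs | ⟨v, t, ht, rfl⟩
      · exact absurd hs hsQ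
      · left
        have h1 := hz.2
        rw [Set.uIcc_of_le (by linarith)] at h1
        exact le_trans (by exact_mod_cast ht) h1.1
    · right
      rcases Finset.mem_insert.1 hs with rfl | hs
      · exact hz.1.ge
      · rw [Finset.mem_singleton.1 hs] at hz
        exact hz.1.ge
  · right
    obtain ⟨k, -, rfl⟩ := Finset.mem_image.1 hs
    have h1 := hz.2
    have h2 : p.2 ≤ (gridPoint p).2 := Nat.le_ceil p.2
    rw [Set.uIcc_of_le h2] at h1
    exact h1.1

end

/-! ### Feasibility and cost of the drawing -/

/-- The solution `S` contains a monotone path from the origin to `z`. -/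
abbrev Reaches (S : Finset Seg) (z : ℝ × ℝ) : Prop := Relation.ReflTransGen (MonoStep S) (0, 0) z

theorem Reaches.mono {S S' : Finset Seg} (hSS : S ⊆ S') {z : ℝ × ℝ} (h : Reaches S z) :
    Reaches S' z := by
  have hle : MonoStep S ≤ MonoStep S' := fun _ _ hab =>
    ⟨hab.1, hab.2.trans (Set.biUnion_subset_biUnion_left hSS)⟩
  exact Relation.ReflTransGen.mono hle _ _ h

theorem Reaches.up {S : Finset Seg} {x y₁ y₂ a b : ℝ} (h : Reaches S (x, a))
    (hs : Seg.vert x y₁ y₂ ∈ S) (h1 : y₁ ≤ a) (hab : a ≤ b) (h2 : b ≤ y₂) : Reaches S (x, b) := by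
  refine h.tail ⟨Or.inl ⟨rfl, hab⟩, fun z hz => Set.mem_iUnion₂.2 ⟨_, hs, ?_⟩⟩
  have hz := segment_subset_Icc (Prod.mk_le_mk.2 ⟨le_rfl, hab⟩) hz
  refine ⟨le_antisymm hz.2.1 hz.1.1, ?_⟩
  rw [Set.uIcc_of_le (by linarith)]
  exact ⟨h1.trans hz.1.2, hz.2.2.trans h2⟩

theorem Reaches.right {S : Finset Seg} {y x₁ x₂ a b : ℝ} (h : Reaches S (a, y))
    (hs : Seg.horiz y x₁ x₂ ∈ S) (h1 : x₁ ≤ a) (hab : a ≤ b) (h2 : b ≤ x₂) :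
    Reaches S (b, y) := by
  refine h.tail ⟨Or.inr ⟨rfl, hab⟩, fun z hz => Set.mem_iUnion₂.2 ⟨_, hs, ?_⟩⟩
  have hz := segment_subset_Icc (Prod.mk_le_mk.2 ⟨hab, le_rfl⟩) hz
  refine ⟨le_antisymm hz.2.2 hz.1.2, ?_⟩
  rw [Set.uIcc_of_le (by linarith)]
  exact ⟨h1.trans hz.1.1, hz.2.1.trans h2⟩

theorem cost_union_le (S T : Finset Seg) : cost (S ∪ T) ≤ cost S + cost T := by
  have h1 := Finset.sum_union_inter (s₁ := S) (s₂ := T) (f := Seg.length)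
  have h2 := cost_nonneg (S ∩ T)
  unfold cost at *
  linarith

theorem cost_image_le {ι : Type*} (I : Finset ι) (f : ι → Seg) {b : ℝ}
    (hb : ∀ i ∈ I, (f i).length ≤ b) : cost (I.image f) ≤ I.card * b := by
  classical
  induction I using Finset.induction_on with
  | empty => simp [cost]
  | insert i I hi ih =>
    rw [Finset.image_insert, Finset.insert_eq, Finset.card_insert_of_notMem hi]
    have h1 := cost_union_le {f i} (I.image f)
    have h2 := hb i (Finset.mem_insert_self i I)
    have h3 := ih fun j hj => hb j (Finset.mem_insert_of_mem hj)
    have h4 : cost {f i} = (f i).length := Finset.sum_singleton _ _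
    push_cast
    linarith

/-- The bound for the number of the copies stored until time `T`: at every time one for the origin,
one for every tail replica and, at every level, one for every active interval. -/
noncomputable def storageBound (σ : SqState) (δ n T : ℕ) : ℕ :=
  ∑ t ∈ Finset.range T, (1 + (σ.tail.filter (fun q => q.2 = t)).card +
    ∑ l ∈ Finset.range (Nat.clog δ n + 1), (activeIntervals σ δ l t (n + 1)).card)

theorem storageBound_handle_le (ch : Choices) (σ : SqState) (r : ℕ × ℕ) (δ n T : ℕ) :
    storageBound σ δ n T ≤ storageBound (σ.handle ch r) δ n T := by
  refine Finset.sum_le_sum fun t _ => Nat.add_le_add (Nat.add_le_add_left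
    (Finset.card_le_card (Finset.filter_subset_filter _ Finset.subset_union_left)) _)
    (Finset.sum_le_sum fun l _ => Finset.card_le_card ?_)
  intro j hj
  obtain ⟨v, hv, ⟨s, hs, hs'⟩, hvj⟩ := mem_activeIntervals.1 hj
  exact mem_activeIntervals.2 ⟨v, hv, ⟨s, Finset.union_subset_union Finset.subset_union_left
    Finset.subset_union_left hs, hs'⟩, hvj⟩

theorem SqState.Valid.storageBound_le {n : ℕ} {σ : SqState} (h : σ.Valid n) {δ : ℕ} (hδ : 0 < δ)
    (T : ℕ) : storageBound σ δ n T ≤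
      T + σ.tail.card + (Nat.clog δ n + 1) * (T + 8 * σ.soln.card) := by
  unfold storageBound
  rw [Finset.sum_add_distrib, Finset.sum_add_distrib, Finset.sum_comm]
  have h1 : ∑ t ∈ Finset.range T, (σ.tail.filter (fun q => q.2 = t)).card ≤ σ.tail.card := by
    rw [← Finset.card_biUnion]
    · exact Finset.card_le_card (Finset.biUnion_subset.2 fun t _ => Finset.filter_subset _ _)
    · intro a _ b _ hab
      exact Finset.disjoint_filter.2 fun q _ h1 h2 => hab (h1.symm.trans h2)
  have h2 := Finset.sum_le_card_nsmul (Finset.range (Nat.clog δ n + 1))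
    (fun l => ∑ t ∈ Finset.range T, (activeIntervals σ δ l t (n + 1)).card) _
    (fun l _ => h.sum_card_activeIntervals_le hδ l (n + 1) T)
  rw [Finset.card_range, smul_eq_mul] at h2
  simp only [Finset.sum_const, Finset.card_range, smul_eq_mul, mul_one]
  omega

/-- The invariants of the grid-rounding algorithm: `Y` is the `y`-coordinate of the last point and
`W` a bound for the cost of the horizontal phases. The solution reaches every node with a copy
at all heights that are at least `Y` and belong to the current unit of time. -/
structure GridState.Valid (δ n : ℕ) (Y W : ℝ) (g : GridState) : Prop where
  on : g.on.Valid δ n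
  nonneg : 0 ≤ Y
  le_time : Y ≤ g.on.time
  reaches : ∀ v ∈ g.on.avail, ∀ y : ℝ, Y ≤ y → (g.on.time : ℝ) - 1 ≤ y → y ≤ g.on.time →
    Reaches g.segs ((v : ℝ), y)
  cost_le : cost g.segs ≤ storageBound g.on.sq δ n g.on.time + W

theorem GridState.valid_init (δ n : ℕ) : GridState.init.Valid δ n 0 0 := by
  refine ⟨OnState.valid_init δ n, le_rfl, by simp, ?_, ?_⟩
  · intro v hv y h1 _ h2
    have hv : v = 0 := by simpa [GridState.init, OnState.init] using hv
    have hy : y = 0 := le_antisymm (by simpa [GridState.init, OnState.init] using h2) h1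
    rw [hv, hy, Nat.cast_zero]
  · simp [GridState.init, cost, storageBound, OnState.init]

section
variable {ch : Choices} {n : ℕ} {Y W : ℝ} {g : GridState}

theorem GridState.Valid.tick (h : g.Valid (delta n) n Y W) (ch : Choices) :
    (g.tick ch n).Valid (delta n) n Y W := by
  have htime : (g.tick ch n).on.time = g.on.time + 1 := rfl
  refine ⟨h.on.tick ch, h.nonneg, ?_, ?_, ?_⟩
  · rw [htime]
    push_cast
    linarith [h.le_time]
  · intro v hv y _ hy1 hy2
    rw [htime] at hy1 hy2
    push_cast at hy1 hy2
    have h1 := h.reaches v (h.on.stored_subset hv) g.on.time h.le_time (by linarith) le_rfl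
    exact (h1.mono Finset.subset_union_left).up
      (Finset.mem_union_right _ (Finset.mem_image_of_mem _ hv)) le_rfl (by linarith) hy2
  · have h1 := cost_union_le g.segs ((g.on.tick ch (delta n) n).cache.image
      (fun v : ℕ => Seg.vert v g.on.time (g.on.time + 1)))
    have h2 := cost_image_le (g.on.tick ch (delta n) n).cache
      (fun v : ℕ => Seg.vert v g.on.time (g.on.time + 1)) (b := 1) (by simp [Seg.length])
    have h3 := h.on.card_stored_le (ch := ch)
    have h4 : storageBound g.on.sq (delta n) n (g.on.time + 1) =
        storageBound g.on.sq (delta n) n g.on.time +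
        (1 + (g.on.sq.tail.filter (fun q => q.2 = g.on.time)).card +
          ∑ l ∈ Finset.range (Nat.clog (delta n) n + 1),
            (activeIntervals g.on.sq (delta n) l g.on.time (n + 1)).card) :=
      Finset.sum_range_succ _ _
    have h5 : (((g.on.tick ch (delta n) n).cache.card : ℕ) : ℝ) +
        storageBound g.on.sq (delta n) n g.on.time ≤
        storageBound g.on.sq (delta n) n (g.on.time + 1) := by
      rw [h4]
      have : (g.on.tick ch (delta n) n).cache.card ≤ _ := h3
      exact_mod_cast (by omega)
    have h6 := h.cost_le
    change cost (g.segs ∪ _) ≤ (storageBound g.on.sq (delta n) n (g.on.time + 1) : ℝ) + W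
    linarith

theorem GridState.Valid.tick_iterate (h : g.Valid (delta n) n Y W) (ch : Choices) (k : ℕ) :
    ((GridState.tick ch n)^[k] g).Valid (delta n) n Y W := by
  induction k with
  | zero => exact h
  | succ k ih =>
    rw [Function.iterate_succ_apply']
    exact ih.tick ch

theorem GridState.Valid.draw (h : g.Valid (delta n) n Y W) (ch : Choices) (hδ : 2 ≤ delta n)
    {p : ℝ × ℝ} (hp : 0 ≤ p.1) (hY : Y ≤ p.2) (ht : (gridPoint p).2 = g.on.time)
    (hn : (gridPoint p).1 ≤ n) :
    (g.draw ch p).Valid (delta n) n p.2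
        (W + ((10 + 20 * delta n) * g.on.sq.rad (gridPoint p) + 2)) ∧
      Reaches (g.draw ch p).segs p := by
  have hp2 : 0 ≤ p.2 := h.nonneg.trans hY
  set r := gridPoint p with hr
  set w := g.on.source r with hw
  obtain ⟨hwa, hwu⟩ := h.on.source_mem r
  obtain ⟨hur, hru, -, -⟩ := h.on.sq.serv_bounds ch r
  have hwr : w ≤ r.1 := hwu.trans hur
  have hx1 : (r.1 : ℝ) ≤ p.1 := Nat.floor_le hp
  have hx2 : p.1 < r.1 + 1 := Nat.lt_floor_add_one _
  have hy1 : p.2 ≤ r.2 := Nat.le_ceil _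
  have hy2 : (r.2 : ℝ) < p.2 + 1 := Nat.ceil_lt_add_one hp2
  have hsub : g.segs ⊆ (g.draw ch p).segs := GridState.segs_subset_draw g p
  have hmem1 : Seg.horiz p.2 w r.1 ∈ (g.draw ch p).segs :=
    Finset.mem_union_left _ (Finset.mem_union_right _ (Finset.mem_insert_self _ _))
  have hmem2 : Seg.horiz p.2 r.1 p.1 ∈ (g.draw ch p).segs :=
    Finset.mem_union_left _ (Finset.mem_union_right _
      (Finset.mem_insert_of_mem (Finset.mem_singleton_self _)))
  have hmem3 : ∀ k ∈ Finset.Icc w r.1, Seg.vert k p.2 r.2 ∈ (g.draw ch p).segs := fun k hk =>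
    Finset.mem_union_right _ (Finset.mem_image_of_mem _ hk)
  have hpath : ∀ k : ℕ, w ≤ k → k ≤ r.1 → Reaches (g.draw ch p).segs ((k : ℝ), p.2) := by
    intro k h1 h2
    have h3 := h.reaches w hwa p.2 hY (by rw [← ht]; linarith) (by rw [← ht]; exact hy1)
    exact (h3.mono hsub).right hmem1 le_rfl (by exact_mod_cast h1) (by exact_mod_cast h2)
  refine ⟨⟨h.on.deliver ch ht hn, hp2, ?_, ?_, ?_⟩, ?_⟩
  · change p.2 ≤ g.on.time
    rw [← ht]
    exact hy1
  · intro v hv y h1 h2 h3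
    change (g.on.time : ℝ) - 1 ≤ y at h2
    change y ≤ (g.on.time : ℝ) at h3
    rcases Finset.mem_union.1 hv with hv | hv
    · exact (h.reaches v hv y (hY.trans h1) h2 h3).mono hsub
    · obtain ⟨h4, h5⟩ := Finset.mem_Icc.1 hv
      exact (hpath v h4 h5).up (hmem3 v hv) le_rfl h1 (by rw [ht]; exact h3)
  · have h1 := cost_union_le (g.segs ∪ {Seg.horiz p.2 w r.1, Seg.horiz p.2 r.1 p.1})
      ((Finset.Icc w r.1).image (fun k : ℕ => Seg.vert k p.2 r.2))
    have h2 := cost_union_le g.segs {Seg.horiz p.2 w r.1, Seg.horiz p.2 r.1 p.1}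
    have h3 := cost_union_le {Seg.horiz p.2 w r.1} {Seg.horiz p.2 r.1 p.1}
    have h4 : cost {Seg.horiz p.2 w r.1} = (r.1 : ℝ) - w := by
      rw [cost, Finset.sum_singleton]
      exact abs_of_nonneg (sub_nonneg.2 (by exact_mod_cast hwr))
    have h5 : cost {Seg.horiz p.2 r.1 p.1} = p.1 - r.1 := by
      rw [cost, Finset.sum_singleton]
      exact abs_of_nonneg (sub_nonneg.2 hx1)
    have h6 := cost_image_le (Finset.Icc w r.1) (fun k : ℕ => Seg.vert k p.2 r.2)
      (b := r.2 - p.2) (fun k _ => (abs_of_nonneg (sub_nonneg.2 hy1)).le)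
    have h7 : ((Finset.Icc w r.1).card : ℝ) = (r.1 : ℝ) + 1 - w := by
      rw [Nat.card_Icc, Nat.cast_sub (by omega)]
      push_cast
      ring
    have h8 : (r.1 : ℝ) ≤ w + (5 + 10 * delta n) * g.on.sq.rad r := by
      have := h.on.servNode_le hδ ht hn
      have h9 : r.1 ≤ w + (5 + 10 * delta n) * g.on.sq.rad r := by
        rw [add_mul]
        omega
      exact_mod_cast h9
    have h9 : (w : ℝ) ≤ r.1 := by exact_mod_cast hwr
    have h10 : ((r.1 : ℝ) + 1 - w) * (r.2 - p.2) ≤ (r.1 + 1 - w) * 1 :=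
      mul_le_mul_of_nonneg_left (by linarith) (by linarith)
    have h11 : (storageBound g.on.sq (delta n) n g.on.time : ℝ) ≤
        storageBound (g.on.sq.handle ch r) (delta n) n g.on.time := by
      exact_mod_cast storageBound_handle_le ch g.on.sq r (delta n) n g.on.time
    have h12 := h.cost_le
    rw [h7] at h6
    rw [← Finset.insert_eq] at h3
    change cost (g.segs ∪ {Seg.horiz p.2 w r.1, Seg.horiz p.2 r.1 p.1} ∪ _) ≤
      (storageBound (g.on.sq.handle ch r) (delta n) n g.on.time : ℝ) + _
    linarith
  · exact (hpath r.1 hwr le_rfl).right hmem2 le_rfl hx1 le_rfl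

/-- The invariants hold along the run, and all points that have been handled are reached. -/
theorem gridRun_valid {N : ℕ} {p : ℕ → ℝ × ℝ} (ch : Choices) (hδ : 2 ≤ delta n)
    (hp : ∀ i < N, 0 ≤ (p i).1 ∧ 0 ≤ (p i).2) (hmono : ∀ i j, i ≤ j → j < N → (p i).2 ≤ (p j).2)
    (hr : IsRequests n N (fun i => gridPoint (p i))) {i : ℕ} (hi : i ≤ N) :
    (gridRun ch n p i).on.sq = sqRun ch (fun i => gridPoint (p i)) i ∧
    (gridRun ch n p i).on.time = (sqRun ch (fun i => gridPoint (p i)) i).time ∧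
    (∀ k < i, Reaches (gridRun ch n p i).segs (p k)) ∧
    ∃ Y, (∀ j, i ≤ j → j < N → Y ≤ (p j).2) ∧ (gridRun ch n p i).Valid (delta n) n Y
      (∑ k ∈ Finset.range i, ((10 + 20 * delta n) *
        (sqRun ch (fun i => gridPoint (p i)) k).rad (gridPoint (p k)) + 2)) := by
  induction i with
  | zero =>
    refine ⟨rfl, rfl, by simp, 0, fun j _ hj => (hp j hj).2, ?_⟩
    rw [Finset.sum_range_zero]
    exact GridState.valid_init _ n
  | succ i ih =>
    obtain ⟨h1, h2, h3, Y, h4, h5⟩ := ih (by omega)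
    have hstep : gridRun ch n p (i + 1) = ((GridState.tick ch n)^[(gridPoint (p i)).2 -
      (gridRun ch n p i).on.time] (gridRun ch n p i)).draw ch (p i) := rfl
    have htime := sqRun_time_le (ch := ch) hr (i := i) (by omega)
    rw [← h2] at htime
    set g' := (GridState.tick ch n)^[(gridPoint (p i)).2 -
      (gridRun ch n p i).on.time] (gridRun ch n p i) with hg'
    have hsq : g'.on.sq = sqRun ch (fun i => gridPoint (p i)) i := by
      rw [hg', GridState.sq_tick_iterate, h1]
    have ht : (gridPoint (p i)).2 = g'.on.time := by
      rw [hg', GridState.time_tick_iterate]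
      omega
    obtain ⟨h6, h7⟩ := (h5.tick_iterate ch _).draw ch hδ (hp i (by omega)).1
      (h4 i le_rfl (by omega)) ht (hr.le i (by omega))
    rw [← hg'] at h6 h7
    rw [hsq] at h6
    rw [hstep]
    refine ⟨?_, ?_, ?_, (p i).2, fun j hj hjN => hmono i j (by omega) hjN, ?_⟩
    · change g'.on.sq.handle ch (gridPoint (p i)) = _
      rw [hsq]
      rfl
    · exact ht.symm
    · intro k hk
      rcases Nat.lt_succ_iff_lt_or_eq.1 hk with hk | rfl
      · exact (h3 k hk).mono ((GridState.segs_subset_tick_iterate _).trans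
          (GridState.segs_subset_draw _ _))
      · exact h7
    · rw [Finset.sum_range_succ]
      exact h6

end

/-! ### Real estimates -/

theorem one_lt_log_of_three_le {n : ℕ} (hn : 3 ≤ n) : 1 < Real.log n := by
  rw [Real.lt_log_iff_exp_lt (by positivity)]
  have h1 := Real.exp_one_lt_d9
  have h2 : (3 : ℝ) ≤ n := by exact_mod_cast hn
  linarith

theorem one_lt_log_div_log_log {n : ℕ} (hn : 3 ≤ n) :
    1 < Real.log n / Real.log (Real.log n) := by
  have h1 := one_lt_log_of_three_le hn
  rw [one_lt_div (Real.log_pos h1)]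
  linarith [Real.log_le_sub_one_of_pos (zero_lt_one.trans h1)]

theorem two_le_delta {n : ℕ} (hn : 3 ≤ n) : 2 ≤ delta n :=
  Nat.lt_ceil.2 (by exact_mod_cast one_lt_log_div_log_log hn)

theorem delta_le {n : ℕ} (hn : 3 ≤ n) :
    (delta n : ℝ) ≤ 2 * (Real.log n / Real.log (Real.log n)) := by
  have h1 := one_lt_log_div_log_log hn
  have h2 := Nat.ceil_lt_add_one (zero_lt_one.trans h1).le
  change (⌈Real.log n / Real.log (Real.log n)⌉₊ : ℝ) ≤ _
  linarith

/-- The number of levels is `O(log n / log log n)`, since `log δ` is at least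
`log log n - log log log n`, hence at least half of `log log n`. -/
theorem clog_delta_le {n : ℕ} (hn : 3 ≤ n) :
    (Nat.clog (delta n) n : ℝ) + 1 ≤ 4 * (Real.log n / Real.log (Real.log n)) := by
  have hL := one_lt_log_div_log_log hn
  have hlog := one_lt_log_of_three_le hn
  have hm := Real.log_pos hlog
  set m := Real.log (Real.log n) with hmdef
  have hδ : Real.log n / m ≤ delta n := Nat.le_ceil _
  have h1 : m / 2 ≤ Real.log (delta n) := by
    have h2 := Real.log_le_log (zero_lt_one.trans hL) hδ
    rw [Real.log_div (zero_lt_one.trans hlog).ne' hm.ne'] at h2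
    have h3 : Real.log m = Real.log (m / 2) + Real.log 2 := by
      rw [← Real.log_mul (by positivity) (by norm_num)]
      congr 1
      ring
    have h4 := Real.log_le_sub_one_of_pos (show 0 < m / 2 by positivity)
    have h5 := Real.log_two_lt_d9
    linarith
  have h2 : ((delta n : ℝ)) ^ (Nat.clog (delta n) n).pred < n := by
    exact_mod_cast Nat.pow_pred_clog_lt_self (two_le_delta hn) (show 1 < n by omega)
  have hδ0 : (0 : ℝ) < delta n := by
    have := two_le_delta hn
    exact_mod_cast (by omega : 0 < delta n)
  have h3 := Real.log_lt_log (by positivity) h2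
  rw [Real.log_pow] at h3
  have h4 : (Nat.clog (delta n) n : ℝ) ≤ (Nat.clog (delta n) n).pred + 1 := by
    have : Nat.clog (delta n) n ≤ (Nat.clog (delta n) n).pred + 1 := by
      rw [Nat.pred_eq_sub_one]
      omega
    exact_mod_cast this
  have h5 : ((Nat.clog (delta n) n).pred : ℝ) * (m / 2) ≤ Real.log n :=
    (mul_le_mul_of_nonneg_left h1 (Nat.cast_nonneg _)).trans h3.le
  have h6 : ((Nat.clog (delta n) n).pred : ℝ) ≤ 2 * (Real.log n / m) := by
    rw [← mul_div_assoc, le_div_iff₀ hm]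
    linarith
  linarith

theorem log_div_log_log_le {n N : ℕ} (hN : 3 ≤ N) (hNn : N ≤ n)
    (h : (n : ℝ) ^ (1 / 4 : ℝ) ≤ N) : Real.log n / Real.log (Real.log n) ≤
      4 * (Real.log N / Real.log (Real.log N)) := by
  have h1 := one_lt_log_of_three_le hN
  have hn : (0 : ℝ) < n := by exact_mod_cast (by omega : 0 < n)
  have h2 : Real.log n ≤ 4 * Real.log N := by
    have := Real.log_le_log (by positivity) h
    rw [Real.log_rpow hn] at this
    linarith
  have h3 : Real.log N ≤ Real.log n :=
    Real.log_le_log (by positivity) (by exact_mod_cast hNn)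
  rw [← mul_div_assoc]
  exact div_le_div₀ (by linarith) h2 (Real.log_pos h1) (Real.log_le_log (by linarith) h3)

theorem fst_le_xMax {Q : List (ℝ × ℝ)} {q : ℝ × ℝ} (hq : q ∈ Q) : q.1 ≤ xMax Q := by
  induction Q with
  | nil => simp at hq
  | cons a Q ih =>
    change q.1 ≤ max a.1 (xMax Q)
    rcases List.mem_cons.1 hq with rfl | hq
    · exact le_max_left _ _
    · exact (ih hq).trans (le_max_right _ _)

theorem xMax_le {Q : List (ℝ × ℝ)} {b : ℝ} (hb : 0 ≤ b) (h : ∀ q ∈ Q, q.1 ≤ b) : xMax Q ≤ b := by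
  induction Q with
  | nil => exact hb
  | cons a Q ih =>
    exact max_le (h a List.mem_cons_self) (ih fun q hq => h q (List.mem_cons_of_mem _ hq))

/-! ### The competitive ratio -/

/-- The algorithm is feasible, and its cost is bounded in terms of the cost of every other feasible
solution. -/
theorem feasible_gridAlg_and_cost_le (ch : Choices) {n : ℕ} (hn : 3 ≤ n) {Q : List (ℝ × ℝ)}
    (hQ : IsInput Q) (hx : xMax Q ≤ n) (hlen : Q.length ≤ n) :
    Feasible Q (gridAlg ch n Q) ∧ ∀ S, Feasible Q S →
      cost (gridAlg ch n Q) ≤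
        1700 * (Real.log n / Real.log (Real.log n)) * (cost S + n) := by
  set N := Q.length with hN
  set p : ℕ → ℝ × ℝ := fun i => Q.getD i (0, 0) with hpdef
  have hpget : ∀ i (hi : i < N), p i = Q[i] := fun i hi => List.getD_eq_getElem Q _ hi
  have hmem : ∀ i < N, p i ∈ Q := fun i hi => by
    rw [hpget i hi]
    exact List.getElem_mem hi
  have hp : ∀ i < N, 0 ≤ (p i).1 ∧ 0 ≤ (p i).2 := fun i hi => hQ.1 _ (hmem i hi)
  have hmono : ∀ i j, i ≤ j → j < N → (p i).2 ≤ (p j).2 := by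
    intro i j hij hj
    rcases hij.eq_or_lt with rfl | hij
    · exact le_rfl
    · rw [hpget i (hij.trans hj), hpget j hj]
      exact List.pairwise_iff_getElem.1 hQ.2 i j _ _ hij
  have hr : IsRequests n N (fun i => gridPoint (p i)) := by
    refine ⟨fun i hi => ?_, fun i j hij hj => Nat.ceil_mono (hmono i j hij hj)⟩
    exact Nat.floor_le_of_le ((fst_le_xMax (hmem i hi)).trans hx)
  have hδ := two_le_delta hn
  obtain ⟨hsq, htime, hreach, Y, -, hV⟩ := gridRun_valid ch hδ hp hmono hr le_rfl
  have halg : gridAlg ch n Q = (gridRun ch n p N).segs := by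
    rw [gridAlg, foldl_eq_seqRun _ _ (0, 0)]
  refine ⟨?_, ?_⟩
  · intro q hq
    obtain ⟨i, hi, rfl⟩ := List.getElem_of_mem hq
    rw [halg, ← hpget i hi]
    exact hreach i hi
  · intro S hS
    have hSp : ∀ i < N, Reaches S (p i) := fun i hi => hS _ (hmem i hi)
    have hcost := hV.cost_le
    rw [hsq, htime, ← halg] at hcost
    set σ := sqRun ch (fun i => gridPoint (p i)) N with hσ
    set R := ∑ i ∈ Finset.range N,
      (sqRun ch (fun i => gridPoint (p i)) i).rad (gridPoint (p i)) with hR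
    have hRle : (R : ℝ) ≤ 3 * (cost S + N) := sum_rad_sqRun_le hr hp hSp
    have hT : (σ.time : ℝ) ≤ cost S + 1 := by
      rcases hN0 : N with _ | k
      · rw [hσ, hN0]
        simpa [seqRun, SqState.init] using add_nonneg (cost_nonneg S) zero_le_one
      · have hk : k < N := by omega
        have h1 : σ.time = ⌈(p k).2⌉₊ := by rw [hσ, hN0]; rfl
        have h2 := Nat.ceil_lt_add_one (hp k hk).2
        have h3 := snd_le_cost (hSp k hk)
        rw [h1]
        linarith
    have hσV : σ.Valid n := sqRun_valid hr le_rfl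
    have hstor := hσV.storageBound_le (δ := delta n) (by omega) σ.time
    have hsoln : σ.soln.card ≤ 1 + σ.time + 14 * R + 3 * N := card_soln_sqRun_le hr le_rfl
    have htail : σ.tail.card ≤ 4 * R + N := card_tail_sqRun_le N
    have hW : ∑ k ∈ Finset.range N, ((10 + 20 * (delta n : ℝ)) *
        ((sqRun ch (fun i => gridPoint (p i)) k).rad (gridPoint (p k)) : ℕ) + 2) =
        (10 + 20 * delta n) * R + 2 * N := by
      rw [Finset.sum_add_distrib, ← Finset.mul_sum, hR]
      push_cast
      simp [mul_comm]
    rw [hW] at hcost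
    set L := Real.log n / Real.log (Real.log n)
    have hL : 1 < L := one_lt_log_div_log_log hn
    have hclog : (Nat.clog (delta n) n : ℝ) + 1 ≤ 4 * L := clog_delta_le hn
    have hdel : (delta n : ℝ) ≤ 2 * L := delta_le hn
    have hn' : (3 : ℝ) ≤ n := by exact_mod_cast hn
    have hNn : (N : ℝ) ≤ n := by exact_mod_cast hlen
    have hC := cost_nonneg S
    -- all quantities are bounded by multiples of `X`
    set X := cost S + n with hX
    have hstor' : (storageBound σ (delta n) n σ.time : ℝ) ≤ σ.time + σ.tail.card +
        (Nat.clog (delta n) n + 1) * (σ.time + 8 * σ.soln.card) := by exact_mod_cast hstor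
    have hsoln' : (σ.soln.card : ℝ) ≤ 1 + σ.time + 14 * R + 3 * N := by exact_mod_cast hsoln
    have htail' : (σ.tail.card : ℝ) ≤ 4 * R + N := by exact_mod_cast htail
    have hRX : (R : ℝ) ≤ 3 * X := by linarith
    have h1 : ((Nat.clog (delta n) n : ℝ) + 1) * (σ.time + 8 * σ.soln.card) ≤
        4 * L * (377 * X) :=
      mul_le_mul hclog (by linarith) (by positivity) (by linarith)
    have h2 : (10 + 20 * (delta n : ℝ)) * R ≤ (10 + 40 * L) * (3 * X) :=
      mul_le_mul (by linarith) hRX (Nat.cast_nonneg _) (by linarith)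
    have h3 : X ≤ L * X := le_mul_of_one_le_left (by linarith) hL.le
    have h4 : 4 * L * (377 * X) = 1508 * (L * X) := by ring
    have h5 : (10 + 40 * L) * (3 * X) = 30 * X + 120 * (L * X) := by ring
    have h6 : 1700 * L * X = 1700 * (L * X) := by ring
    linarith

end RSA

theorem mainTheorem6 :
    ∃ c : ℝ, 0 < c ∧ ∀ (ch : RSA.Choices) (n : ℕ), 3 ≤ n →
      RSA.IsOnline (RSA.gridAlg ch n) ∧
      ∀ Q : List (ℝ × ℝ), RSA.IsInput Q → RSA.xMax Q ≤ n → Q.length ≤ n →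
        RSA.Feasible Q (RSA.gridAlg ch n Q) ∧
        RSA.cost (RSA.gridAlg ch n Q) ≤
          c * (Real.log n / Real.log (Real.log n)) * (RSA.optCost Q + n) ∧
        (3 ≤ Q.length → (n : ℝ) ^ (1 / 4 : ℝ) ≤ Q.length → (n : ℝ) / 2 ≤ RSA.xMax Q →
          RSA.cost (RSA.gridAlg ch n Q) ≤
            c * (Real.log Q.length / Real.log (Real.log Q.length)) * RSA.optCost Q) := by
  -- `20400 = 1700 * 3 * 4`: the additive `n` costs a factor of `3`, passing from `n` to `N`
  -- a factor of `4`
  refine ⟨20400, by norm_num, fun ch n hn => ⟨RSA.isOnline_gridAlg ch n, ?_⟩⟩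
  intro Q hQ hx hlen
  obtain ⟨hfeas, hcost⟩ := RSA.feasible_gridAlg_and_cost_le ch hn hQ hx hlen
  have hne : (RSA.cost '' {S | RSA.Feasible Q S}).Nonempty := ⟨_, _, hfeas, rfl⟩
  set L := Real.log n / Real.log (Real.log n)
  have hL : 1 < L := RSA.one_lt_log_div_log_log hn
  have hopt : RSA.cost (RSA.gridAlg ch n Q) ≤ 1700 * L * (RSA.optCost Q + n) := by
    have h1 : RSA.cost (RSA.gridAlg ch n Q) / (1700 * L) - n ≤ RSA.optCost Q := by
      refine le_csInf hne ?_
      rintro _ ⟨S, hS, rfl⟩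
      rw [sub_le_iff_le_add, div_le_iff₀' (by positivity)]
      exact hcost S hS
    rwa [sub_le_iff_le_add, div_le_iff₀' (by positivity)] at h1
  have hopt0 : 0 ≤ RSA.optCost Q := by
    refine le_csInf hne ?_
    rintro _ ⟨S, -, rfl⟩
    exact RSA.cost_nonneg S
  refine ⟨hfeas, hopt.trans ?_, ?_⟩
  · have : 0 ≤ L * (RSA.optCost Q + n) := by positivity
    linarith
  · intro hN hNn hxn
    have hxopt : RSA.xMax Q ≤ RSA.optCost Q := by
      refine le_csInf hne ?_
      rintro _ ⟨S, hS, rfl⟩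
      exact RSA.xMax_le (RSA.cost_nonneg S) fun q hq => RSA.fst_le_cost (hS q hq)
    have h1 := RSA.log_div_log_log_le hN hlen hNn
    calc RSA.cost (RSA.gridAlg ch n Q) ≤ 1700 * L * (RSA.optCost Q + n) := hopt
      _ ≤ 1700 * L * (3 * RSA.optCost Q) :=
          mul_le_mul_of_nonneg_left (by linarith) (by positivity)
      _ = 5100 * RSA.optCost Q * L := by ring
      _ ≤ 5100 * RSA.optCost Q * (4 * (Real.log Q.length / Real.log (Real.log Q.length))) :=
          mul_le_mul_of_nonneg_left h1 (by positivity)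
      _ = _ := by ring
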